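/- **Setting.** Let $\Sigma=\mathbb{N}_0^{\mathbb{Z}}$, ordered coordinatewise ($\preccurlyeq$), and for a finite $I\subset\mathbb{Z}$ put $\eta(I)=\sum_{x\in I}\eta(x)$. Let $J=(a,b)$ with $0\le a<b<\infty$. An *environment* consists of probability measures $\mu_\rho$ on $\Sigma$ ($\rho\in J$), each invariant under the translations of $\mathbb{Z}$, and of a Markov kernel $\eta_0\mapsto\mathbf{P}^{\eta_0}$ giving the law of a process $(\eta_t)_{t\in\mathbb{N}_0}$ in $\Sigma$ started from $\eta_0\in\Sigma$, such that, with $\mathbf{P}^\rho=\int\mu_\rho(d\eta_0)\mathbf{P}^{\eta_0}$: * (P.1) under $\mathbf{P}^{\eta_0}$, for all $s\in\mathbb{N}_0$ and $x\in\mathbb{Z}$, given $\eta_0,\dots,\eta_s$ the process $(\eta_{s+t}(x+\cdot))_{t\ge0}$ has law $\mathbf{P}^{\eta_s(x+\cdot)}$; * (P.2) under $\mathbf{P}^\rho$, $(\eta_{s+t})_{t\ge0}$ has the same law as $(\eta_t)_{t\ge0}$ for all $s\in\mathbb{N}_0$, $\rho\in J$; * (P.3) if $\eta_0'\preccurlyeq\eta_0$,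 then $\mathbf{P}^{\eta_0'}$ and $\mathbf{P}^{\eta_0}$ can be coupled so that a.s. $\eta'_t\preccurlyeq\eta_t$ for all $t$; if $\rho'\le\rho$ in $J$, then $\mu_{\rho'}$ and $\mu_\rho$ can be coupled so that a.s. $\eta_0'\preccurlyeq\eta_0$; * (P.4) there is $c>0$ such that for all $\rho\in J$, $\varepsilon\in(0,1)$ and integers $\ell\ge1$, $\mathbf{P}^\rho(|\eta_0(\{0,\dots,\ell-1\})-\rho\ell|\ge\varepsilon\ell)\le2e^{-c\varepsilon^2\ell}$. Assume moreover that for some $\nu>0$ the following two conditions hold (intervals are intersected with $\mathbb{Z}$). * (No particle drifting in from the side.) For all integers $t,H\ge0$, $k\ge1$ and all $\eta_0,\eta_0'\in\Sigma$ with $\eta_0\succcurlyeq\eta'_0$ on $[-H,H]$, there is a coupling $\mathbb{Q}$ of $\mathbf{P}^{\eta_0}$ and $\mathbf{P}^{\eta_0'}$ with $$\mathbb{Q}\big(\forall s\in\{0,\dots,t\}:\ \eta_s\succcurlyeq\eta_s'\text{ on }[-H+2\nu kt,H-2\nu kt]\big)\ge1-20e^{-k\nu t/4}.$$ * (Covering.)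 There are $C,C'>0$ such that for all $\rho\in J$ and $\varepsilon\in(0,1)$ with $\rho+\varepsilon\in J$, and all integers $H,t\ge1$ with $H>4\nu t$, $\nu^8t>1$ and $\nu t^{1/4}>C\varepsilon^{-2}(1+|\log^3(\nu t)|)$, the following holds with $\ell=\lfloor t^{1/4}\rfloor$. If $\eta_0(I)\ge(\rho+\tfrac{3\varepsilon}4)|I|$ and $\eta_0'(I)\le(\rho+\tfrac\varepsilon4)|I|$ for every interval $I\subset[-H,H]$ with $\lfloor\ell/2\rfloor\le|I|\le\ell$, then there is a coupling $\mathbb{Q}$ of $\mathbf{P}^{\eta_0}$ and $\mathbf{P}^{\eta_0'}$ with $$\mathbb{Q}\big(\eta_t\succcurlyeq\eta_t'\text{ on }[-H+4\nu t,H-4\nu t]\big)\ge1-C'tH\exp\!\Big(-\frac{\varepsilon^2t^{1/4}}{C'(1+\nu^{-1})}\Big).$$ Fix $0\le p_\circ<p_\bullet\le1$. Given $\eta=(\eta_t)_{t\in\mathbb{N}_0}$ and i.i.d. uniform variables $U_0,U_1,\dots$ on $[0,1]$ independent of $\eta$, the walk is $X_0=0$, $$X_{n+1}=X_n+2\cdot\mathbf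 1\{U_n\le(p_\circ-p_\bullet)\mathbf 1\{\eta_n(X_n)=0\}+p_\bullet\}-1 .$$ Let $\mathbb{P}^\rho$ be the joint (annealed) law when $\eta\sim\mathbf{P}^\rho$. For $L\ge1$, let $\mathbb{E}^{\rho,L}$ be the corresponding expectation when the environment is instead resampled from $\mu_\rho$, independently of the past, at each multiple of $L$, evolving as before in between. Put $v(\rho,L)=\mathbb{E}^{\rho,L}[X_L/L]$, let $\bar J$ be the set of $\rho\in J$ for which $v(\rho)=\lim_{L\to\infty}v(\rho,L)$ exists, and $$v^+(\rho)=\lim_{\rho'\downarrow\rho,\ \rho'\in\bar J}v(\rho'),\qquad v^-(\rho)=\lim_{\rho'\uparrow\rho,\ \rho'\in\bar J}v(\rho').$$ **Lemma 4.2 (Deviation Lemma).** Let $\rho\in J$. Then $\rho$ is an accumulation point of both $\bar J\cap(\rho,\infty)$ and $\bar J\cap(-\infty,\rho)$, and the limits $v^+(\rho)$ and $v^-(\rho)$ exist in $\mathbb{R}$. Moreover, for every $\delta>0$ there is $k_0=k_0(\rho,\delta)\in\mathbb{N}$ such that for all integers $n\ge L>k_0$ with $n\ge12L/\delta$ and every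 real number $f(L)\in[(\log L)^{90},L^{1/10}]$, $$\mathbb{P}^\rho\Big(\frac{X_n}n\notin\big(v^-(\rho)-\delta,\ v^+(\rho)+\delta\big)\Big)\le2\Big(\Big\lceil\frac nL\Big\rceil-1\Big)^2\exp\!\big(-f(L)^{1/40}\big)+2\exp\!\Big(-\frac{\delta^2n}{2^9L}\Big).$$ -/

import Mathlib

open MeasureTheory ProbabilityTheory Filter Topology

/-- Particle configurations on `ℤ` (number of particles at each site). -/
abbrev Config : Type := ℤ → ℕ

/-- Space-time trajectories `η = (η_t)_{t = 0, 1, 2, …}` of a particle configuration. -/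
abbrev EnvPath : Type := ℕ → Config

/-- The configuration seen from `x`, i.e. `σ(x + ·)`. -/
def Config.translate (x : ℤ) (σ : Config) : Config := fun y => σ (x + y)

/-- The trajectory seen from time `s` and site `x`, i.e. `(η_{s+t}(x + ·))_{t ≥ 0}`. -/
def EnvPath.shift (s : ℕ) (x : ℤ) (η : EnvPath) : EnvPath :=
  fun t => Config.translate x (η (s + t))

/-- `σ(I)`, the number of particles in the interval `I = {y, …, y + m - 1}` of length `m`. -/
noncomputable def Config.mass (σ : Config) (y : ℤ) (m : ℕ) : ℕ := ∑ x ∈ Finset.Ico y (y + m), σ x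

/-- `σ` dominates `σ'` at all integer sites of the real interval `[-r, r]`. -/
def DominatesOn (r : ℝ) (σ σ' : Config) : Prop := ∀ x : ℤ, |(x : ℝ)| ≤ r → σ' x ≤ σ x

/-- `Q` is a coupling of the laws `P` and `P'`. -/
def IsCoupling {α : Type*} [MeasurableSpace α] (Q : Measure (α × α)) (P P' : Measure α) : Prop :=
  Q.map Prod.fst = P ∧ Q.map Prod.snd = P'

/-- A dynamic random environment with densities in the interval `J = (a, b)`: a family of initial
laws `μ ρ` (only `ρ ∈ (a, b)` matters) and the laws `P σ` of the evolution started from `σ`,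
which is Markov, stationary under `μ ρ`, monotone, and has density `ρ` under `μ ρ`. -/
structure Environment (a b : ℝ) where
  /-- the law of the initial configuration at density `ρ` -/
  μ : ℝ → ProbabilityMeasure Config
  /-- the law of the environment started from a given configuration -/
  P : Kernel Config EnvPath
  [markovKernel : IsMarkovKernel P]
  /-- the evolution `P σ` starts from `σ` -/
  start : ∀ σ : Config, ∀ᵐ η ∂(P σ), η 0 = σ
  /-- Time-homogeneous Markov property and translation invariance of the dynamics: under `P σ`,
  given `η_0, …, η_s`, the process `(η_{s+t}(x + ·))_t` has law `P (η_s(x + ·))`. -/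
  markov : ∀ (σ : Config) (s : ℕ) (x : ℤ) (A B : Set EnvPath), MeasurableSet A →
    MeasurableSet[Filtration.piLE (X := fun _ : ℕ => Config) s] B →
    P σ (B ∩ EnvPath.shift s x ⁻¹' A) = ∫⁻ η in B, P (Config.translate x (η s)) A ∂(P σ)
  /-- the initial laws are translation invariant -/
  translation_invariant : ∀ ρ ∈ Set.Ioo a b, ∀ x : ℤ,
    (μ ρ : Measure Config).map (Config.translate x) = μ ρ
  /-- the environment started from `μ ρ` is stationary in time -/
  stationary : ∀ ρ ∈ Set.Ioo a b, ∀ s : ℕ,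
    ((μ ρ : Measure Config).bind P).map (EnvPath.shift s 0) = (μ ρ : Measure Config).bind P
  /-- quenched monotonicity -/
  monotone_quenched : ∀ σ σ' : Config, σ' ≤ σ → ∃ Q : Measure (EnvPath × EnvPath),
    IsCoupling Q (P σ) (P σ') ∧ ∀ᵐ ω ∂Q, ∀ t : ℕ, ω.2 t ≤ ω.1 t
  /-- monotonicity of the initial laws in the density -/
  monotone_density : ∀ ρ ∈ Set.Ioo a b, ∀ ρ' ∈ Set.Ioo a b, ρ' ≤ ρ →
    ∃ Q : Measure (Config × Config),
      IsCoupling Q (μ ρ : Measure Config) (μ ρ' : Measure Config) ∧ ∀ᵐ ω ∂Q, ω.2 ≤ ω.1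
  /-- concentration of the density -/
  density : ∃ c : ℝ, 0 < c ∧ ∀ ρ ∈ Set.Ioo a b, ∀ ε ∈ Set.Ioo (0 : ℝ) 1, ∀ l : ℕ, 1 ≤ l →
    ((μ ρ : Measure Config).bind P).real
        {η | ε * l ≤ |((η 0).mass 0 l : ℝ) - ρ * l|} ≤ 2 * Real.exp (-(c * ε ^ 2 * l))

namespace Environment

attribute [instance] Environment.markovKernel

variable {a b : ℝ}

/-- Condition "no particle drifting in from the side", with activity rate `ν`. -/
def NoDriftIn (E : Environment a b) (ν : ℝ) : Prop :=
  ∀ (t H k : ℕ), 1 ≤ k → ∀ σ σ' : Config, DominatesOn H σ σ' →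
    ∃ Q : Measure (EnvPath × EnvPath), IsCoupling Q (E.P σ) (E.P σ') ∧
      1 - 20 * Real.exp (-(k * ν * t / 4)) ≤
        Q.real {ω | ∀ s ≤ t, DominatesOn (H - 2 * ν * k * t) (ω.1 s) (ω.2 s)}

/-- Condition "covering of `η'` by `η`", with activity rate `ν`: two environments whose empirical
densities on `[-H, H]` are ordered can be coupled such that the denser one covers the other at
time `t` on a slightly smaller interval, with high probability. -/
def Covering (E : Environment a b) (ν : ℝ) : Prop :=
  ∃ C C' : ℝ, 0 < C ∧ 0 < C' ∧
    ∀ ρ ∈ Set.Ioo a b, ∀ ε ∈ Set.Ioo (0 : ℝ) 1, ρ + ε ∈ Set.Ioo a b →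
    ∀ H t : ℕ, 1 ≤ H → 1 ≤ t → 4 * ν * t < H → 1 < ν ^ 8 * t →
    C * (ε ^ 2)⁻¹ * (1 + |Real.log (ν * t) ^ 3|) < ν * (t : ℝ) ^ (1 / 4 : ℝ) →
    ∀ σ σ' : Config,
      (∀ (y : ℤ) (m : ℕ), ⌊(t : ℝ) ^ (1 / 4 : ℝ)⌋₊ / 2 ≤ m → m ≤ ⌊(t : ℝ) ^ (1 / 4 : ℝ)⌋₊ →
        Finset.Ico y (y + m) ⊆ Finset.Icc (-(H : ℤ)) H →
          (ρ + 3 * ε / 4) * m ≤ σ.mass y m ∧ (σ'.mass y m : ℝ) ≤ (ρ + ε / 4) * m) →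
      ∃ Q : Measure (EnvPath × EnvPath), IsCoupling Q (E.P σ) (E.P σ') ∧
        1 - C' * t * H * Real.exp (-((C' * (1 + ν⁻¹))⁻¹ * ε ^ 2 * (t : ℝ) ^ (1 / 4 : ℝ))) ≤
          Q.real {ω | DominatesOn (H - 4 * ν * t) (ω.1 t) (ω.2 t)}

/-- The law of the environment started from `μ ρ`. -/
noncomputable def law (E : Environment a b) (ρ : ℝ) : Measure EnvPath :=
  (E.μ ρ : Measure Config).bind E.P

instance (E : Environment a b) (ρ : ℝ) : IsProbabilityMeasure (E.law ρ) := by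
  unfold law; infer_instance

/-- The law of the finite-range environment: at the times `0, L, 2L, …` the configuration is
resampled from `μ ρ` independently of the past, and it evolves by the original dynamics in
between. Thus the successive blocks of length `L` are taken from independent copies. -/
noncomputable def finiteRangeLaw (E : Environment a b) (ρ : ℝ) (L : ℕ) : Measure EnvPath :=
  (Measure.infinitePi (fun _ : ℕ => E.law ρ)).map (fun ω t => ω (t / L) (t % L))

end Environment

/-- The random walk from `0` in the environment `η`, driven by the numbers `u_n ∈ [0,1]`; it jumps
to the right at time `n` iff `u_n ≤ (pE - pO) 1{η_n(X_n) = 0} + pO`, so with probability `pE` on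
empty sites and `pO` on occupied sites if `u_n` is uniform. -/
noncomputable def walk (pE pO : ℝ) (η : EnvPath) (u : ℕ → unitInterval) : ℕ → ℤ
  | 0 => 0
  | n + 1 => walk pE pO η u n +
      2 * (if (u n : ℝ) ≤ (pE - pO) * (if η n (walk pE pO η u n) = 0 then 1 else 0) + pO
        then 1 else 0) - 1

/-- The joint annealed law of the environment and of the i.i.d. uniform variables `(U_n)`, when
the environment has law `Q`. -/
noncomputable def annealed (Q : Measure EnvPath) : Measure (EnvPath × (ℕ → unitInterval)) :=
  Q.prod (Measure.infinitePi (fun _ : ℕ => (volume : Measure unitInterval)))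

namespace Environment

variable {a b : ℝ}

/-- `v(ρ, L)`, the mean of `X_L / L` in the finite-range environment. -/
noncomputable def finiteRangeSpeed (E : Environment a b) (pE pO ρ : ℝ) (L : ℕ) : ℝ :=
  ∫ ω, (walk pE pO ω.1 ω.2 L : ℝ) / L ∂(annealed (E.finiteRangeLaw ρ L))

/-- The densities `ρ ∈ (a, b)` at which `v(ρ, L)` converges as `L → ∞`. -/
def speedDomain (E : Environment a b) (pE pO : ℝ) : Set ℝ :=
  {ρ | ρ ∈ Set.Ioo a b ∧ ∃ v : ℝ, Tendsto (E.finiteRangeSpeed pE pO ρ) atTop (𝓝 v)}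

/-- `v(ρ) = lim_{L → ∞} v(ρ, L)`; meaningful for `ρ` in `speedDomain`. -/
noncomputable def speed (E : Environment a b) (pE pO ρ : ℝ) : ℝ :=
  limUnder atTop (E.finiteRangeSpeed pE pO ρ)

/-- `v⁺(ρ)`, the limit of `v(ρ')` as `ρ' ↓ ρ` within `speedDomain`. -/
noncomputable def speedPlus (E : Environment a b) (pE pO ρ : ℝ) : ℝ :=
  limUnder (𝓝[E.speedDomain pE pO ∩ Set.Ioi ρ] ρ) (E.speed pE pO)

/-- `v⁻(ρ)`, the limit of `v(ρ')` as `ρ' ↑ ρ` within `speedDomain`. -/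
noncomputable def speedMinus (E : Environment a b) (pE pO ρ : ℝ) : ℝ :=
  limUnder (𝓝[E.speedDomain pE pO ∩ Set.Iio ρ] ρ) (E.speed pE pO)

end Environment

/-! The walk is compared, block by block, with independent blocks in a fresh environment of slightly
different density. Cut time into blocks of length `L`. By stationarity the environment at the start
of a block has law `μ ρ`, so with high probability its empirical density is near `ρ` on a wide
window, whatever the past did. From any such configuration, and for an upper deviation, the covering
condition lets an environment of density `ρ + ε` dominate the true one after a short time `l ^ 4 ≤
√L`, and the no-drift condition keeps it above for the rest of the block. Jumps are monotone in the
particle numbers and the two walkers have equal parity, so a head start of `2 * l ^ 4` keeps the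
walker in the denser environment ahead. This is `measure_block_le`; lower deviations use `ρ - ε`
with the roles exchanged.

Replacing blocks one at a time (`annealed_walk_add_le`, `annealed_walk_mul_le`) bounds the tail of
the walk by that of a sum of independent copies of `X_L` at density `ρ ± ε`, whose mean is `L` times
the finite-range speed. Hoeffding's inequality and a choice of scales give `exists_deviation_bound`,
valid for every `ε ≥ L ^ (-1/32)`.

The same bound with `ε = L ^ (-1/32)` compares speeds at different scales: up to a vanishing error,
the speed at a scale `n ≥ L ^ 2` is at most the speed at scale `L` and a slightly larger density
(`exists_finiteRangeSpeed_le`). Hence the limsup of the speeds at `ρ` is at most their liminf at any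
`ρ' > ρ`. The limsup is monotone in the density, so it has countably many discontinuities, and at
its continuity points the speed exists. Monotonicity and boundedness then give the one-sided limits.
For the deviation estimate, pick densities in `speedDomain` on both sides of `ρ` with speeds close
to the one-sided limits and apply the block bound with these fixed values of `ε`. -/

open scoped ENNReal

/-! ### The walk started from an arbitrary site -/

/-- The walk of `walk`, started from `x` instead of `0`. -/
noncomputable def walkFrom (pE pO : ℝ) (x : ℤ) (η : EnvPath) (u : ℕ → unitInterval) (n : ℕ) : ℤ :=
  x + walk pE pO (EnvPath.shift 0 x η) u n

/-- The jump of the walk that sits on a site with `k` particles and sees the number `r`. -/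
noncomputable def jump (pE pO : ℝ) (k : ℕ) (r : unitInterval) : ℤ :=
  2 * (if (r : ℝ) ≤ (pE - pO) * (if k = 0 then 1 else 0) + pO then 1 else 0) - 1

lemma jump_eq_one_or (pE pO : ℝ) (k : ℕ) (r : unitInterval) :
    jump pE pO k r = 1 ∨ jump pE pO k r = -1 := by
  unfold jump
  by_cases h : (r : ℝ) ≤ (pE - pO) * (if k = 0 then 1 else 0) + pO
  · left; rw [if_pos h]; norm_num
  · right; rw [if_neg h]; norm_num

lemma jump_mono {pE pO : ℝ} (hp : pE ≤ pO) {k k' : ℕ} (h : k ≤ k') (r : unitInterval) :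
    jump pE pO k r ≤ jump pE pO k' r := by
  have key : (pE - pO) * (if k = 0 then 1 else 0) ≤ (pE - pO) * (if k' = 0 then 1 else 0) := by
    by_cases hk : k = 0
    · by_cases hk' : k' = 0
      · simp [hk, hk']
      · simp [hk, hk', hp]
    · have hk' : k' ≠ 0 := by omega
      simp [hk, hk']
  unfold jump
  by_cases h1 : (r : ℝ) ≤ (pE - pO) * (if k = 0 then 1 else 0) + pO
  · have h2 : (r : ℝ) ≤ (pE - pO) * (if k' = 0 then 1 else 0) + pO := by linarith
    rw [if_pos h1, if_pos h2]
  · rw [if_neg h1]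
    split_ifs <;> norm_num

section
variable (pE pO : ℝ) (x : ℤ) (η : EnvPath) (u : ℕ → unitInterval) (n : ℕ)

@[simp] lemma walkFrom_zero : walkFrom pE pO x η u 0 = x := by simp [walkFrom, walk]

lemma walkFrom_succ : walkFrom pE pO x η u (n + 1) =
    walkFrom pE pO x η u n + jump pE pO (η n (walkFrom pE pO x η u n)) (u n) := by
  have h : ∀ y, EnvPath.shift 0 x η n y = η n (x + y) := fun y => by
    simp [EnvPath.shift, Config.translate]
  simp only [walkFrom, walk, jump, h]
  rw [add_sub_assoc, add_assoc]
  rfl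

lemma walk_eq_walkFrom : walk pE pO η u n = walkFrom pE pO 0 η u n := by
  have h : EnvPath.shift 0 0 η = η := by
    ext t y; simp [EnvPath.shift, Config.translate]
  simp [walkFrom, h]

lemma walkFrom_eq_add : walkFrom pE pO x η u n =
    x + walkFrom pE pO 0 (EnvPath.shift 0 x η) u n := by
  rw [← walk_eq_walkFrom]; rfl

lemma walkFrom_add (s : ℕ) : walkFrom pE pO x η u (s + n) =
    walkFrom pE pO (walkFrom pE pO x η u s) (EnvPath.shift s 0 η) (fun k => u (s + k)) n := by
  induction n with
  | zero => simp
  | succ n ih =>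
    rw [← add_assoc, walkFrom_succ, walkFrom_succ, ih]
    simp [EnvPath.shift, Config.translate]

lemma abs_walkFrom_sub_le : |walkFrom pE pO x η u n - x| ≤ n := by
  induction n with
  | zero => simp
  | succ n ih =>
    rw [walkFrom_succ]
    rcases jump_eq_one_or pE pO (η n (walkFrom pE pO x η u n)) (u n) with h | h <;>
    · rw [h]; rw [abs_le] at *; push_cast; constructor <;> linarith [ih.1, ih.2]

lemma two_dvd_walkFrom_sub : (2 : ℤ) ∣ walkFrom pE pO x η u n - x - n := by
  induction n with
  | zero => simp
  | succ n ih =>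
    rw [walkFrom_succ]
    rcases jump_eq_one_or pE pO (η n (walkFrom pE pO x η u n)) (u n) with h | h <;>
    · rw [h]; push_cast; omega

end

lemma walkFrom_congr (pE pO : ℝ) (x : ℤ) {η η' : EnvPath} {u u' : ℕ → unitInterval} {n : ℕ}
    (hη : ∀ k < n, η k = η' k) (hu : ∀ k < n, u k = u' k) :
    walkFrom pE pO x η u n = walkFrom pE pO x η' u' n := by
  induction n with
  | zero => simp
  | succ n ih =>
    rw [walkFrom_succ, walkFrom_succ, ih (fun k hk => hη k (by omega)) (fun k hk => hu k (by omega)),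
      hη n (by omega), hu n (by omega)]

/-- Walkers of equal parity that are strictly ordered are at least 2 apart, so one step of size 1
each cannot make them cross. When they meet they use the same uniform variable, and the one seeing
more particles jumps at least as far right. Domination is needed only on sites the left walker can
reach, all within `r`. -/
lemma walkFrom_mono {pE pO : ℝ} (hp : pE ≤ pO) {x x' : ℤ} (hx : x ≤ x') (hpar : (2 : ℤ) ∣ x' - x)
    {η η' : EnvPath} (u : ℕ → unitInterval) {n : ℕ} {r : ℝ} (hr : |(x : ℝ)| + n ≤ r)
    (h : ∀ s < n, DominatesOn r (η' s) (η s)) :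
    walkFrom pE pO x η u n ≤ walkFrom pE pO x' η' u n := by
  induction n with
  | zero => simpa
  | succ n ih =>
    have hr' : |(x : ℝ)| + n ≤ r := by push_cast at hr; linarith
    have ih := ih hr' (fun s hs => h s (by omega))
    have h1 := two_dvd_walkFrom_sub pE pO x η u n
    have h2 := two_dvd_walkFrom_sub pE pO x' η' u n
    rw [walkFrom_succ, walkFrom_succ]
    rcases ih.lt_or_eq with hlt | heq
    · have j1 := jump_eq_one_or pE pO (η n (walkFrom pE pO x η u n)) (u n)
      have j2 := jump_eq_one_or pE pO (η' n (walkFrom pE pO x' η' u n)) (u n)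
      omega
    · rw [← heq]
      have hw := abs_walkFrom_sub_le pE pO x η u n
      have hw' : |((walkFrom pE pO x η u n : ℤ) : ℝ)| ≤ r := by
        have : |((walkFrom pE pO x η u n : ℤ) : ℝ) - x| ≤ n := by exact_mod_cast hw
        have := abs_sub_abs_le_abs_sub ((walkFrom pE pO x η u n : ℤ) : ℝ) x
        linarith
      have := jump_mono hp (h n (by omega) _ hw') (u n)
      linarith

lemma walkFrom_mono_left {pE pO : ℝ} (hp : pE ≤ pO) {x x' : ℤ} (hx : x ≤ x')
    (hpar : (2 : ℤ) ∣ x' - x) (η : EnvPath) (u : ℕ → unitInterval) (n : ℕ) :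
    walkFrom pE pO x η u n ≤ walkFrom pE pO x' η u n :=
  walkFrom_mono hp hx hpar u le_rfl (fun _ _ _ _ => le_rfl)

/-! ### Measurability -/

lemma measurable_config_apply {α : Type*} {m : MeasurableSpace α} {f : α → Config} {g : α → ℤ}
    (hf : Measurable f) (hg : Measurable g) : Measurable (fun a => f a (g a)) := by
  have : Measurable (fun p : Config × ℤ => p.1 p.2) :=
    measurable_from_prod_countable_left (fun y => measurable_pi_apply y)
  exact this.comp (hf.prodMk hg)

lemma measurable_jump (pE pO : ℝ) : Measurable (fun p : ℕ × unitInterval => jump pE pO p.1 p.2) := by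
  refine measurable_from_prod_countable_right (fun k => ?_)
  have h (c : ℝ) : Measurable
      (fun r : unitInterval => 2 * (if (r : ℝ) ≤ c then (1 : ℤ) else 0) - 1) :=
    ((Measurable.ite (measurableSet_le measurable_subtype_coe measurable_const)
      measurable_const measurable_const).const_mul _).sub_const _
  exact h ((pE - pO) * (if k = 0 then 1 else 0) + pO)

lemma measurable_walkFrom_of {α : Type*} {m : MeasurableSpace α} (pE pO : ℝ) {x : α → ℤ}
    {η : α → EnvPath} {u : α → ℕ → unitInterval} (n : ℕ) (hx : Measurable x)
    (hη : ∀ k < n, Measurable (fun a => η a k)) (hu : ∀ k < n, Measurable (fun a => u a k)) :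
    Measurable (fun a => walkFrom pE pO (x a) (η a) (u a) n) := by
  induction n with
  | zero => simpa
  | succ n ih =>
    have ih := ih (fun k hk => hη k (by omega)) (fun k hk => hu k (by omega))
    simp only [walkFrom_succ]
    exact ih.add ((measurable_jump pE pO).comp
      ((measurable_config_apply (hη n (by omega)) ih).prodMk (hu n (by omega))))

@[fun_prop] lemma measurable_walkFrom {α : Type*} {m : MeasurableSpace α} (pE pO : ℝ) {x : α → ℤ}
    {η : α → EnvPath} {u : α → ℕ → unitInterval} (n : ℕ) (hx : Measurable x)
    (hη : Measurable η) (hu : Measurable u) :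
    Measurable (fun a => walkFrom pE pO (x a) (η a) (u a) n) :=
  measurable_walkFrom_of pE pO n hx (fun k _ => (measurable_pi_apply k).comp hη)
    (fun k _ => (measurable_pi_apply k).comp hu)

@[fun_prop] lemma measurable_translate (x : ℤ) : Measurable (Config.translate x) :=
  measurable_pi_lambda _ (fun y => measurable_pi_apply (x + y))

@[fun_prop] lemma measurable_shift (s : ℕ) (x : ℤ) : Measurable (EnvPath.shift s x) :=
  measurable_pi_lambda _ (fun t => (measurable_translate x).comp (measurable_pi_apply (s + t)))

/-- The position at time `s` uses only the configurations before `s`, so it may serve as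
conditioning data in the Markov property. -/
lemma measurable_walkFrom_piLE (pE pO : ℝ) (x : ℤ) (u : ℕ → unitInterval) (s : ℕ) :
    Measurable[Filtration.piLE (X := fun _ : ℕ => Config) s]
      (fun η : EnvPath => walkFrom pE pO x η u s) := by
  refine measurable_walkFrom_of (m := Filtration.piLE (X := fun _ : ℕ => Config) s) pE pO s
    measurable_const (fun k hk => ?_) (fun _ _ => measurable_const)
  rw [Filtration.piLE_eq_comap_frestrictLe]
  have : (fun η : EnvPath => η k) =
      (fun w : (i : Finset.Iic s) → Config => w ⟨k, by simp; omega⟩) ∘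
        (Preorder.frestrictLe (π := fun _ : ℕ => Config) s) := rfl
  rw [this]
  exact (measurable_pi_apply _).comp (comap_measurable _)

/-- `σ` has empirical density close to `ρ` on the intervals of the scale `l` with left endpoint in
`[-r, r]`. -/
def NearDensity (ρ ε : ℝ) (l r : ℕ) (σ : Config) : Prop :=
  ∀ (y : ℤ) (m : ℕ), |y| ≤ r → l / 2 ≤ m → m ≤ l → |(σ.mass y m : ℝ) - ρ * m| ≤ ε / 4 * m

@[fun_prop] lemma measurable_mass (y : ℤ) (m : ℕ) : Measurable (fun σ : Config => σ.mass y m) := by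
  unfold Config.mass
  exact Finset.measurable_sum _ (fun x _ => measurable_pi_apply x)

lemma measurableSet_nearDensity (ρ ε : ℝ) (l r : ℕ) : MeasurableSet {σ | NearDensity ρ ε l r σ} := by
  unfold NearDensity
  simp only [Set.ofPred_forall]
  refine .iInter fun y => .iInter fun m => .iInter fun _ => .iInter fun _ => .iInter fun _ => ?_
  refine measurableSet_le ?_ measurable_const
  have : Measurable (fun σ : Config => (σ.mass y m : ℝ)) :=
    (measurable_from_top (f := fun k : ℕ => (k : ℝ))).comp (measurable_mass y m)
  exact measurable_norm.comp (this.sub_const _)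

lemma measurableSet_dominatesOn {α : Type*} {m : MeasurableSpace α} (r : ℝ) {f g : α → Config}
    (hf : Measurable f) (hg : Measurable g) : MeasurableSet {a | DominatesOn r (f a) (g a)} := by
  unfold DominatesOn
  simp only [Set.ofPred_forall]
  refine .iInter fun x => .iInter fun _ => ?_
  exact measurableSet_le ((measurable_pi_apply x).comp hg) ((measurable_pi_apply x).comp hf)

lemma mass_translate (σ : Config) (x y : ℤ) (m : ℕ) :
    (Config.translate x σ).mass y m = σ.mass (x + y) m := by
  unfold Config.mass Config.translate
  rw [add_assoc, ← Finset.sum_image (s := Finset.Ico y (y + m)) (g := fun z => x + z) (f := σ)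
    (by intro a _ b _ h; simpa using h)]
  rw [Finset.image_add_left_Ico]

lemma NearDensity.translate {ρ ε : ℝ} {l r r' : ℕ} {σ : Config} (h : NearDensity ρ ε l r' σ)
    (x : ℤ) (hx : |x| + r ≤ r') : NearDensity ρ ε l r (Config.translate x σ) := by
  intro y m hy h1 h2
  rw [mass_translate]
  refine h _ m ?_ h1 h2
  have := abs_add_le x y
  omega

lemma NearDensity.mono {ρ ε : ℝ} {l r r' : ℕ} {σ : Config} (h : NearDensity ρ ε l r' σ)
    (hr : r ≤ r') : NearDensity ρ ε l r σ :=
  fun y m hy h1 h2 => h y m (hy.trans (by exact_mod_cast hr)) h1 h2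

/-! ### Splitting a sequence of i.i.d. variables -/

/-- The first `s` terms of `u`, followed by `v`. -/
def concatAt {β : Type*} (s : ℕ) (u v : ℕ → β) : ℕ → β := fun n => if n < s then u n else v (n - s)

lemma concatAt_add {β : Type*} (s : ℕ) (u v : ℕ → β) : (fun k => concatAt s u v (s + k)) = v := by
  ext k; simp [concatAt]

lemma measurable_concatAt {β : Type*} [MeasurableSpace β] (s : ℕ) :
    Measurable (fun p : (ℕ → β) × (ℕ → β) => concatAt s p.1 p.2) := by
  refine measurable_pi_lambda _ (fun n => ?_)
  unfold concatAt
  split_ifs <;> fun_prop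

/-- The preimage of a cylinder is a product of two cylinders, one on the coordinates below `s` and
one on the others shifted down by `s`. This makes the uniforms of a block independent of the earlier
ones. -/
lemma map_concatAt {β : Type*} [MeasurableSpace β] (P : Measure β) [IsProbabilityMeasure P]
    (s : ℕ) :
    ((Measure.infinitePi (fun _ : ℕ => P)).prod (Measure.infinitePi (fun _ : ℕ => P))).map
      (fun p => concatAt s p.1 p.2) = Measure.infinitePi (fun _ : ℕ => P) := by
  classical
  refine Measure.eq_infinitePi _ (fun I t ht => ?_)
  rw [Measure.map_apply (measurable_concatAt s) (MeasurableSet.pi I.countable_toSet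
    (fun i _ => ht i))]
  have : (fun p : (ℕ → β) × (ℕ → β) => concatAt s p.1 p.2) ⁻¹' (Set.pi I t) =
      (Set.pi (I.filter (· < s)) t) ×ˢ
        (Set.pi ((I.filter (¬ · < s)).image (· - s)) (fun k => t (s + k))) := by
    ext p
    simp only [Set.mem_preimage, Set.mem_pi, Set.mem_prod, Finset.mem_coe, Finset.mem_filter,
      Finset.mem_image, concatAt]
    constructor
    · intro h
      refine ⟨fun i hi => by simpa [hi.2] using h i hi.1, ?_⟩
      rintro k ⟨i, ⟨hi, his⟩, rfl⟩
      have := h i hi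
      rw [if_neg his] at this
      convert this using 2
      omega
    · rintro ⟨h1, h2⟩ i hi
      by_cases his : i < s
      · simpa [his] using h1 i ⟨hi, his⟩
      · rw [if_neg his]
        have := h2 (i - s) ⟨i, ⟨hi, his⟩, rfl⟩
        convert this using 2
        omega
  rw [this, Measure.prod_prod, Measure.infinitePi_pi _ (fun i _ => ht i),
    Measure.infinitePi_pi _ (fun i _ => ht _), Finset.prod_image,
    ← Finset.prod_filter_mul_prod_filter_not I (· < s)]
  · congr 1
    refine Finset.prod_congr rfl (fun i hi => ?_)
    simp only [Finset.mem_filter] at hi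
    congr 2; omega
  · intro i hi j hj h
    simp only [Finset.coe_filter, Set.mem_ofPred_eq] at hi hj
    simp only at h
    omega

/-! ### Couplings and exceptional events. -/

namespace IsCoupling

variable {α : Type*} [MeasurableSpace α] {Q : Measure (α × α)} {P P' : Measure α}

lemma measure_fst (h : IsCoupling Q P P') {A : Set α} (hA : MeasurableSet A) :
    P A = Q {ω | ω.1 ∈ A} := by
  rw [← h.1, Measure.map_apply measurable_fst hA]; rfl

lemma measure_snd (h : IsCoupling Q P P') {A : Set α} (hA : MeasurableSet A) :
    P' A = Q {ω | ω.2 ∈ A} := by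
  rw [← h.2, Measure.map_apply measurable_snd hA]; rfl

lemma lintegral_fst (h : IsCoupling Q P P') {f : α → ℝ≥0∞} (hf : Measurable f) :
    ∫⁻ a, f a ∂P = ∫⁻ ω, f ω.1 ∂Q := by
  rw [← h.1, lintegral_map hf measurable_fst]

lemma lintegral_snd (h : IsCoupling Q P P') {f : α → ℝ≥0∞} (hf : Measurable f) :
    ∫⁻ a, f a ∂P' = ∫⁻ ω, f ω.2 ∂Q := by
  rw [← h.2, lintegral_map hf measurable_snd]

lemma isProbabilityMeasure [IsProbabilityMeasure P] (h : IsCoupling Q P P') :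
    IsProbabilityMeasure Q := by
  refine ⟨?_⟩
  have := h.measure_fst (A := Set.univ) MeasurableSet.univ
  simpa using this.symm

lemma measure_compl_le [IsProbabilityMeasure P] (h : IsCoupling Q P P') {A : Set (α × α)}
    (hA : MeasurableSet A) {x : ℝ} (hx : 1 - x ≤ Q.real A) : Q Aᶜ ≤ ENNReal.ofReal x := by
  have := h.isProbabilityMeasure
  rw [← ofReal_measureReal, probReal_compl_eq_one_sub hA]
  exact ENNReal.ofReal_le_ofReal (by linarith)

end IsCoupling

lemma Config.translate_zero (σ : Config) : Config.translate 0 σ = σ := by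
  ext y; simp [Config.translate]

/-- Bounding an integral of a probability by means of an exceptional set. -/
lemma lintegral_le_lintegral_add_of_subset {α : Type*} [MeasurableSpace α] {Q : Measure α}
    [IsProbabilityMeasure Q] {f g : α → ℝ≥0∞} {B : Set α} (hB : MeasurableSet B) {e : ℝ≥0∞}
    (hg : Measurable g) (hf : ∀ a, f a ≤ 1) (h : ∀ a ∉ B, f a ≤ g a + e) :
    ∫⁻ a, f a ∂Q ≤ ∫⁻ a, g a ∂Q + e + Q B := by
  calc ∫⁻ a, f a ∂Q ≤ ∫⁻ a, (g a + e + B.indicator 1 a) ∂Q := by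
        refine lintegral_mono (fun a => ?_)
        by_cases ha : a ∈ B
        · simp only [Set.indicator_of_mem ha, Pi.one_apply]
          exact (hf a).trans le_add_self
        · simpa [Set.indicator_of_notMem ha] using h a ha
    _ = _ := by
        rw [lintegral_add_left (hg.add_const e), lintegral_add_left hg, lintegral_const,
          lintegral_indicator_one hB]
        simp

/-! ### Markov property, translations, and comparison of walks under covering. -/

namespace Environment

variable {a b : ℝ} (E : Environment a b)

lemma measure_translate (σ : Config) (x : ℤ) {A : Set EnvPath} (hA : MeasurableSet A) :
    E.P (Config.translate x σ) A = E.P σ {η | EnvPath.shift 0 x η ∈ A} := by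
  have h := E.markov σ 0 x A Set.univ hA MeasurableSet.univ
  rw [Set.univ_inter, Measure.restrict_univ] at h
  calc E.P (Config.translate x σ) A = ∫⁻ _, E.P (Config.translate x σ) A ∂(E.P σ) := by simp
    _ = ∫⁻ η, E.P (Config.translate x (η 0)) A ∂(E.P σ) := by
        refine lintegral_congr_ae ?_
        filter_upwards [E.start σ] with η hη
        rw [hη]
    _ = _ := h.symm

/-- The field `markov` treats a fixed future event. Here the event depends on the past through `N`,
which has countably many values, so it suffices to split over the fibres of `N`. -/
lemma measure_shift_mem (σ : Config) (s : ℕ) {N : EnvPath → ℤ}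
    (hN : Measurable[Filtration.piLE (X := fun _ : ℕ => Config) s] N) {A : ℤ → Set EnvPath}
    (hA : ∀ y, MeasurableSet (A y)) :
    E.P σ {η | EnvPath.shift s 0 η ∈ A (N η)} = ∫⁻ η, E.P (η s) (A (N η)) ∂(E.P σ) := by
  have hB (y : ℤ) : MeasurableSet[Filtration.piLE (X := fun _ : ℕ => Config) s] (N ⁻¹' {y}) :=
    hN (measurableSet_singleton y)
  have hB' (y : ℤ) : MeasurableSet (N ⁻¹' {y}) :=
    (Filtration.piLE (X := fun _ : ℕ => Config)).le s _ (hB y)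
  have hdisj : Pairwise (Function.onFun Disjoint fun y : ℤ => N ⁻¹' {y}) := by
    intro y z hyz
    refine Set.disjoint_left.mpr (fun η h1 h2 => hyz ?_)
    simp only [Set.mem_preimage, Set.mem_singleton_iff] at h1 h2
    rw [← h1, ← h2]
  have e1 : {η | EnvPath.shift s 0 η ∈ A (N η)} =
      ⋃ y, (N ⁻¹' {y} ∩ EnvPath.shift s 0 ⁻¹' A y) := by
    ext η; simp
  have e2 : (⋃ y, N ⁻¹' {y}) = Set.univ := by ext η; simp
  rw [e1, measure_iUnion (fun y z hyz => (hdisj hyz).mono Set.inter_subset_left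
      Set.inter_subset_left) (fun y => (hB' y).inter (measurable_shift s 0 (hA y))),
    ← setLIntegral_univ, ← e2, lintegral_iUnion hB' hdisj]
  refine tsum_congr (fun y => ?_)
  rw [E.markov σ s 0 (A y) _ (hA y) (hB y)]
  refine setLIntegral_congr_fun (hB' y) (fun η hη => ?_)
  simp only [Set.mem_preimage, Set.mem_singleton_iff] at hη
  simp only [Config.translate_zero, hη]

lemma law_apply (ρ : ℝ) {A : Set EnvPath} (hA : MeasurableSet A) :
    E.law ρ A = ∫⁻ σ, E.P σ A ∂(E.μ ρ : Measure Config) :=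
  Measure.bind_apply hA E.P.measurable.aemeasurable

lemma lintegral_law (ρ : ℝ) {f : EnvPath → ℝ≥0∞} (hf : Measurable f) :
    ∫⁻ η, f η ∂(E.law ρ) = ∫⁻ σ, ∫⁻ η, f η ∂(E.P σ) ∂(E.μ ρ : Measure Config) :=
  Measure.lintegral_bind E.P.measurable.aemeasurable hf.aemeasurable

lemma measurable_measure_of_nat {α : Type*} {m : MeasurableSpace α} {f : α → Config} {g : α → ℤ}
    (hf : Measurable f) (hg : Measurable g) {A : ℤ → Set EnvPath} (hA : ∀ y, MeasurableSet (A y)) :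
    Measurable (fun x => E.P (f x) (A (g x))) := by
  have : Measurable (fun p : Config × ℤ => E.P p.1 (A p.2)) :=
    measurable_from_prod_countable_left (fun y => E.P.measurable_coe (hA y))
  exact this.comp (hf.prodMk hg)

lemma law_shift_mem (ρ : ℝ) (s : ℕ) {N : EnvPath → ℤ}
    (hN : Measurable[Filtration.piLE (X := fun _ : ℕ => Config) s] N) {A : ℤ → Set EnvPath}
    (hA : ∀ y, MeasurableSet (A y)) :
    E.law ρ {η | EnvPath.shift s 0 η ∈ A (N η)} = ∫⁻ η, E.P (η s) (A (N η)) ∂(E.law ρ) := by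
  have hN' : Measurable N := hN.mono ((Filtration.piLE (X := fun _ : ℕ => Config)).le s) le_rfl
  have hm : MeasurableSet {η | EnvPath.shift s 0 η ∈ A (N η)} := by
    have : MeasurableSet {p : EnvPath × ℤ | p.1 ∈ A p.2} := by
      have : {p : EnvPath × ℤ | p.1 ∈ A p.2} = ⋃ y, A y ×ˢ {y} := by ext p; simp
      rw [this]
      exact .iUnion fun y => (hA y).prod (measurableSet_singleton y)
    exact ((measurable_shift s 0).prodMk hN') this
  rw [E.law_apply ρ hm,
    E.lintegral_law ρ (E.measurable_measure_of_nat (measurable_pi_apply s) hN' hA)]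
  exact lintegral_congr (fun σ => E.measure_shift_mem σ s hN hA)

lemma measurableSet_walkFrom (pE pO : ℝ) (x : ℤ) (u : ℕ → unitInterval) (n : ℕ) (p : ℤ → Prop) :
    MeasurableSet {η : EnvPath | p (walkFrom pE pO x η u n)} :=
  (measurable_walkFrom pE pO n measurable_const measurable_id measurable_const)
    (MeasurableSet.of_discrete (s := {z | p z}))

lemma measure_walkFrom_add (σ : Config) (pE pO : ℝ) (x : ℤ) (u : ℕ → unitInterval) (s n : ℕ)
    (p : ℤ → Prop) :
    E.P σ {η | p (walkFrom pE pO x η u (s + n))} =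
      ∫⁻ η, E.P (η s) {ζ | p (walkFrom pE pO (walkFrom pE pO x η u s) ζ (fun k => u (s + k)) n)}
        ∂(E.P σ) := by
  rw [← E.measure_shift_mem σ s (measurable_walkFrom_piLE pE pO x u s)
    (A := fun y => {ζ | p (walkFrom pE pO y ζ (fun k => u (s + k)) n)})
    (fun y => measurableSet_walkFrom pE pO y _ n p)]
  simp only [walkFrom_add]; rfl

lemma law_walkFrom_add (ρ : ℝ) (pE pO : ℝ) (x : ℤ) (u : ℕ → unitInterval) (s n : ℕ)
    (p : ℤ → Prop) :
    E.law ρ {η | p (walkFrom pE pO x η u (s + n))} =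
      ∫⁻ η, E.P (η s) {ζ | p (walkFrom pE pO (walkFrom pE pO x η u s) ζ (fun k => u (s + k)) n)}
        ∂(E.law ρ) := by
  rw [← E.law_shift_mem ρ s (measurable_walkFrom_piLE pE pO x u s)
    (A := fun y => {ζ | p (walkFrom pE pO y ζ (fun k => u (s + k)) n)})
    (fun y => measurableSet_walkFrom pE pO y _ n p)]
  simp only [walkFrom_add]; rfl

lemma measure_walkFrom_eq (σ : Config) (pE pO : ℝ) (x y : ℤ) (u : ℕ → unitInterval) (n : ℕ)
    (p : ℤ → Prop) :
    E.P σ {η | p (walkFrom pE pO (x + y) η u n)} =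
      E.P (Config.translate x σ) {η | p (x + walkFrom pE pO y η u n)} := by
  rw [E.measure_translate σ x (measurableSet_walkFrom pE pO y u n (fun z => p (x + z)))]
  congr 1; ext η
  have : walkFrom pE pO (x + y) η u n = x + walkFrom pE pO y (EnvPath.shift 0 x η) u n := by
    rw [walkFrom_eq_add, walkFrom_eq_add pE pO y]
    have : EnvPath.shift 0 (x + y) η = EnvPath.shift 0 y (EnvPath.shift 0 x η) := by
      ext t z; simp [EnvPath.shift, Config.translate, add_assoc]
    rw [this, add_assoc]
  simp only [Set.mem_ofPred_eq, this]

lemma law_walkFrom_eq {ρ : ℝ} (hρ : ρ ∈ Set.Ioo a b) (pE pO : ℝ) (x : ℤ) (u : ℕ → unitInterval)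
    (n : ℕ) (p : ℤ → Prop) :
    E.law ρ {η | p (walkFrom pE pO x η u n)} = E.law ρ {η | p (x + walkFrom pE pO 0 η u n)} := by
  have hm := measurableSet_walkFrom pE pO 0 u n (fun z => p (x + z))
  rw [E.law_apply ρ (measurableSet_walkFrom pE pO x u n p), E.law_apply ρ hm]
  have h := E.measure_walkFrom_eq (pE := pE) (pO := pO) (x := x) (y := 0) (u := u) (n := n) (p := p)
  simp only [add_zero] at h
  simp only [h]
  nth_rewrite 2 [← E.translation_invariant ρ hρ x]
  rw [lintegral_map (E.P.measurable_coe hm) (measurable_translate x)]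

/-- If the environment started from `τ` covers the one started from `σ` after time `t`, and
domination is kept for a further time `n`, then the walk among `τ`, given a head start `2 t`, is
stochastically to the right of the walk among `σ`. -/
lemma measure_walk_le_of_cover {pE pO : ℝ} (hp : pE ≤ pO) {σ τ : Config} {t n : ℕ} {r r' : ℝ}
    {e₁ e₂ : ℝ≥0∞}
    (hcov : ∃ Q : Measure (EnvPath × EnvPath), IsCoupling Q (E.P τ) (E.P σ) ∧
      Q {ω | DominatesOn r (ω.1 t) (ω.2 t)}ᶜ ≤ e₁)
    (hkeep : ∀ ξ ξ', DominatesOn r ξ ξ' → ∃ Q : Measure (EnvPath × EnvPath),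
      IsCoupling Q (E.P ξ) (E.P ξ') ∧ Q {ω | ∀ s ≤ n, DominatesOn r' (ω.1 s) (ω.2 s)}ᶜ ≤ e₂)
    (hr' : (t : ℝ) + n ≤ r') (u : ℕ → unitInterval) (c : ℤ) :
    E.P σ {η | c ≤ walkFrom pE pO 0 η u (t + n)} ≤
      E.P τ {η | c ≤ walkFrom pE pO (2 * t) η u (t + n)} + (e₂ + e₁) := by
  set v : ℕ → unitInterval := fun k => u (t + k) with hv
  set Φ : Config → ℤ → ℝ≥0∞ := fun ξ x => E.P ξ {ζ | c ≤ walkFrom pE pO x ζ v n} with hΦ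
  have hΦm (x : ℤ) : Measurable (fun ξ => Φ ξ x) :=
    E.P.measurable_coe (measurableSet_walkFrom pE pO x v n (fun z => c ≤ z))
  have hΦm' : Measurable (fun η : EnvPath => Φ (η t) t) := (hΦm t).comp (measurable_pi_apply t)
  have hmono (ξ : Config) {x x' : ℤ} (hx : x ≤ x') (hpar : (2 : ℤ) ∣ x' - x) : Φ ξ x ≤ Φ ξ x' :=
    measure_mono (fun ζ (hζ : c ≤ _) => hζ.trans (walkFrom_mono_left hp hx hpar ζ v n))
  have hdom (ξ ξ' : Config) (h : DominatesOn r ξ ξ') : Φ ξ' t ≤ Φ ξ t + e₂ := by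
    obtain ⟨Q, hQ, hQe⟩ := hkeep ξ ξ' h
    simp only [hΦ]
    rw [hQ.measure_fst (measurableSet_walkFrom pE pO t v n (fun z => c ≤ z)),
      hQ.measure_snd (measurableSet_walkFrom pE pO t v n (fun z => c ≤ z))]
    refine (measure_mono (t := {ω | ω.1 ∈ {ζ | c ≤ walkFrom pE pO t ζ v n}} ∪
      {ω | ∀ s ≤ n, DominatesOn r' (ω.1 s) (ω.2 s)}ᶜ) ?_).trans
      ((measure_union_le _ _).trans (by gcongr))
    intro ω hω
    by_cases hg : ∀ s ≤ n, DominatesOn r' (ω.1 s) (ω.2 s)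
    · left
      refine le_trans (b := walkFrom pE pO t ω.2 v n) hω
        (walkFrom_mono hp le_rfl (by simp) v (r := r') ?_ (fun s hs => hg s hs.le))
      simpa using hr'
    · right; exact hg
  obtain ⟨Q, hQ, hQe⟩ := hcov
  have := hQ.isProbabilityMeasure
  rw [E.measure_walkFrom_add σ, E.measure_walkFrom_add τ]
  -- Before time `t` no domination is available. But the walker from `0` is then at most at `t`, the
  -- walker from `2 t` at least at `t`, and parities agree; moving both to `t` leaves only the
  -- configurations to compare.
  calc ∫⁻ η, Φ (η t) (walkFrom pE pO 0 η u t) ∂(E.P σ)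
      ≤ ∫⁻ η, Φ (η t) t ∂(E.P σ) := by
        refine lintegral_mono (fun η => hmono _ ?_ ?_)
        · have := abs_le.mp (abs_walkFrom_sub_le pE pO 0 η u t); linarith
        · have := two_dvd_walkFrom_sub pE pO 0 η u t; omega
    _ = ∫⁻ ω, Φ (ω.2 t) t ∂Q := hQ.lintegral_snd hΦm'
    _ ≤ ∫⁻ ω, Φ (ω.1 t) t ∂Q + e₂ + Q {ω | DominatesOn r (ω.1 t) (ω.2 t)}ᶜ := by
        refine lintegral_le_lintegral_add_of_subset ?_ (hΦm'.comp measurable_fst)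
          (fun ω => prob_le_one) (fun ω hω => hdom _ _ (by simpa using hω))
        exact (measurableSet_dominatesOn r ((measurable_pi_apply t).comp measurable_fst)
          ((measurable_pi_apply t).comp measurable_snd)).compl
    _ ≤ ∫⁻ η, Φ (η t) t ∂(E.P τ) + e₂ + e₁ := by
        rw [hQ.lintegral_fst hΦm']; gcongr
    _ ≤ ∫⁻ η, Φ (η t) (walkFrom pE pO (2 * t) η u t) ∂(E.P τ) + (e₂ + e₁) := by
        rw [add_assoc]
        gcongr with η
        refine hmono _ ?_ ?_
        · have := abs_le.mp (abs_walkFrom_sub_le pE pO (2 * t) η u t); linarith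
        · have := two_dvd_walkFrom_sub pE pO (2 * t) η u t; omega

end Environment

lemma measure_compl_le_compl_add {α β : Type*} [MeasurableSpace α] [MeasurableSpace β]
    {P : Measure α} {P' : Measure β} [IsProbabilityMeasure P] [IsProbabilityMeasure P']
    {A : Set α} {A' : Set β} (hA : MeasurableSet A) (hA' : MeasurableSet A') {e : ℝ≥0∞}
    (h : P A ≤ P' A' + e) : P' A'ᶜ ≤ P Aᶜ + e := by
  have h1 : P' A' + P' A'ᶜ ≤ P' A' + (P Aᶜ + e) := by
    calc P' A' + P' A'ᶜ = P A + P Aᶜ := by rw [prob_add_prob_compl hA', prob_add_prob_compl hA]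
      _ ≤ P' A' + e + P Aᶜ := by gcongr
      _ = _ := by ring
  exact (ENNReal.add_le_add_iff_left (measure_ne_top _ _)).mp h1

/-! ### Concentration of the density and comparison of one block with a fresh block. -/

namespace Environment

variable {a b : ℝ} (E : Environment a b)

/-- The covering condition with given constants `C` and `C'`. -/
def CoveringWith (ν C C' : ℝ) : Prop :=
  ∀ ρ ∈ Set.Ioo a b, ∀ ε ∈ Set.Ioo (0 : ℝ) 1, ρ + ε ∈ Set.Ioo a b →
    ∀ H t : ℕ, 1 ≤ H → 1 ≤ t → 4 * ν * t < H → 1 < ν ^ 8 * t →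
    C * (ε ^ 2)⁻¹ * (1 + |Real.log (ν * t) ^ 3|) < ν * (t : ℝ) ^ (1 / 4 : ℝ) →
    ∀ σ σ' : Config,
      (∀ (y : ℤ) (m : ℕ), ⌊(t : ℝ) ^ (1 / 4 : ℝ)⌋₊ / 2 ≤ m → m ≤ ⌊(t : ℝ) ^ (1 / 4 : ℝ)⌋₊ →
        Finset.Ico y (y + m) ⊆ Finset.Icc (-(H : ℤ)) H →
          (ρ + 3 * ε / 4) * m ≤ σ.mass y m ∧ (σ'.mass y m : ℝ) ≤ (ρ + ε / 4) * m) →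
      ∃ Q : Measure (EnvPath × EnvPath), IsCoupling Q (E.P σ) (E.P σ') ∧
        1 - C' * t * H * Real.exp (-((C' * (1 + ν⁻¹))⁻¹ * ε ^ 2 * (t : ℝ) ^ (1 / 4 : ℝ))) ≤
          Q.real {ω | DominatesOn (H - 4 * ν * t) (ω.1 t) (ω.2 t)}

/-- The concentration of the density with a given constant `c`. -/
def DensityWith (c : ℝ) : Prop :=
  ∀ ρ ∈ Set.Ioo a b, ∀ ε ∈ Set.Ioo (0 : ℝ) 1, ∀ l : ℕ, 1 ≤ l →
    ((E.μ ρ : Measure Config).bind E.P).real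
        {η | ε * l ≤ |((η 0).mass 0 l : ℝ) - ρ * l|} ≤ 2 * Real.exp (-(c * ε ^ 2 * l))

lemma measurableSet_time (s : ℕ) {A : Set Config} (hA : MeasurableSet A) :
    MeasurableSet {η : EnvPath | η s ∈ A} := measurable_pi_apply s hA

lemma law_apply_zero (ρ : ℝ) {A : Set Config} (hA : MeasurableSet A) :
    E.law ρ {η | η 0 ∈ A} = (E.μ ρ : Measure Config) A := by
  rw [E.law_apply ρ (measurableSet_time 0 hA), ← lintegral_indicator_one hA]
  refine lintegral_congr (fun σ => ?_)
  by_cases h : σ ∈ A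
  · rw [Set.indicator_of_mem h, Pi.one_apply]
    refine (mem_ae_iff_prob_eq_one (measurableSet_time 0 hA)).mp ?_
    filter_upwards [E.start σ] with η hη
    simpa [hη] using h
  · rw [Set.indicator_of_notMem h, ← prob_compl_eq_one_iff (measurableSet_time 0 hA)]
    refine (mem_ae_iff_prob_eq_one (measurableSet_time 0 hA).compl).mp ?_
    filter_upwards [E.start σ] with η hη
    simpa [hη] using h

lemma law_apply_time {ρ : ℝ} (hρ : ρ ∈ Set.Ioo a b) (s : ℕ) {A : Set Config}
    (hA : MeasurableSet A) : E.law ρ {η | η s ∈ A} = (E.μ ρ : Measure Config) A := by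
  rw [← E.law_apply_zero ρ hA]
  have h := E.stationary ρ hρ s
  change (E.law ρ).map _ = E.law ρ at h
  nth_rewrite 2 [← h]
  rw [Measure.map_apply (measurable_shift s 0) (measurableSet_time 0 hA)]
  simp [EnvPath.shift, Config.translate_zero]

/-- A union bound over left endpoints and lengths. Translation invariance moves each interval to the
origin, and the worst exponent is that of the shortest length `l / 2`. -/
lemma measure_not_nearDensity_le {c : ℝ} (hd : E.DensityWith c) {ρ : ℝ} (hρ : ρ ∈ Set.Ioo a b)
    {ε : ℝ} (hε : ε ∈ Set.Ioo (0 : ℝ) 1) (hc : 0 ≤ c) {l : ℕ} (hl : 2 ≤ l) (r : ℕ) :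
    (E.μ ρ : Measure Config) {σ | NearDensity ρ ε l r σ}ᶜ ≤
      ENNReal.ofReal ((2 * r + 1) * (l + 1) *
        (2 * Real.exp (-(c * (ε / 4) ^ 2 * (l / 2 : ℕ))))) := by
  have hone (y : ℤ) (m : ℕ) (hm : l / 2 ≤ m) : (E.μ ρ : Measure Config)
      {σ | ε / 4 * m < |(σ.mass y m : ℝ) - ρ * m|} ≤
        ENNReal.ofReal (2 * Real.exp (-(c * (ε / 4) ^ 2 * (l / 2 : ℕ)))) := by
    have hmeas (y : ℤ) : MeasurableSet {σ : Config | ε / 4 * m ≤ |(σ.mass y m : ℝ) - ρ * m|} := by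
      have : Measurable (fun σ : Config => (σ.mass y m : ℝ)) :=
        (measurable_from_top (f := fun k : ℕ => (k : ℝ))).comp (measurable_mass y m)
      exact measurableSet_le measurable_const (measurable_norm.comp (this.sub_const _))
    have h1 : 1 ≤ m := by omega
    have := hd ρ hρ (ε / 4) ⟨by linarith [hε.1], by linarith [hε.1, hε.2]⟩ m h1
    calc (E.μ ρ : Measure Config) {σ | ε / 4 * m < |(σ.mass y m : ℝ) - ρ * m|}
        ≤ (E.μ ρ : Measure Config) {σ | ε / 4 * m ≤ |(σ.mass y m : ℝ) - ρ * m|} :=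
          measure_mono (fun σ hσ => by
            simp only [Set.mem_ofPred_eq] at hσ ⊢; exact hσ.le)
      _ = (E.μ ρ : Measure Config) {σ | ε / 4 * m ≤ |(σ.mass 0 m : ℝ) - ρ * m|} := by
          nth_rewrite 2 [← E.translation_invariant ρ hρ y]
          rw [Measure.map_apply (measurable_translate y) (hmeas 0)]
          simp only [Set.preimage_ofPred_eq, mass_translate, add_zero]
      _ = E.law ρ {η | ε / 4 * m ≤ |((η 0).mass 0 m : ℝ) - ρ * m|} :=
          (E.law_apply_zero ρ (hmeas 0)).symm
      _ ≤ ENNReal.ofReal (2 * Real.exp (-(c * (ε / 4) ^ 2 * m))) := by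
          rw [← ofReal_measureReal]
          exact ENNReal.ofReal_le_ofReal this
      _ ≤ _ := by gcongr
  have hsub : {σ | NearDensity ρ ε l r σ}ᶜ ⊆ ⋃ p ∈ Finset.Icc (-(r : ℤ)) r ×ˢ Finset.Icc (l / 2) l,
      {σ : Config | ε / 4 * p.2 < |(σ.mass p.1 p.2 : ℝ) - ρ * p.2|} := by
    intro σ hσ
    simp only [NearDensity, Set.mem_compl_iff, Set.mem_ofPred_eq, not_forall, not_le] at hσ
    obtain ⟨y, m, hy, h1, h2, h3⟩ := hσ
    simp only [Set.mem_iUnion, Finset.mem_product, Finset.mem_Icc]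
    exact ⟨(y, m), ⟨abs_le.mp hy, h1, h2⟩, h3⟩
  refine (measure_mono hsub).trans ((measure_biUnion_finset_le _ _).trans ?_)
  refine (Finset.sum_le_sum (fun p hp => hone p.1 p.2 ?_)).trans ?_
  · simp only [Finset.mem_product, Finset.mem_Icc] at hp
    exact hp.2.1
  · rw [Finset.sum_const, nsmul_eq_mul, ENNReal.ofReal_mul (p := (2 * r + 1) * (l + 1)) (by positivity)]
    gcongr
    rw [← ENNReal.ofReal_natCast]
    refine ENNReal.ofReal_le_ofReal ?_
    have h1 : ((Finset.Icc (-(r : ℤ)) r ×ˢ Finset.Icc (l / 2) l).card : ℕ) ≤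
        (2 * r + 1) * (l + 1) := by
      rw [Finset.card_product, Int.card_Icc, Nat.card_Icc]
      exact Nat.mul_le_mul (by omega) (by omega)
    exact_mod_cast h1

/-- The probability that the comparison of a block with a fresh block fails because of the
coupling. -/
noncomputable def couplingError (ν C' ε : ℝ) (l n H : ℕ) : ℝ≥0∞ :=
  ENNReal.ofReal (20 * Real.exp (-(ν * n / 4))) +
    ENNReal.ofReal (C' * (l ^ 4 : ℕ) * H * Real.exp (-((C' * (1 + ν⁻¹))⁻¹ * ε ^ 2 * l)))

variable {E}

/-- Covering is run for time `l ^ 4`, whose fourth root is exactly the scale `l`. Errors `ε / 4`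
around `ρ` and `ρ + ε` leave the thresholds `ρ + ε / 4` and `ρ + 3 ε / 4` that covering asks for.
The window shrinks from `H` to `H'` during covering, then by `2 ν n` while domination is kept (with
`k = 1`), and still contains all reachable sites. -/
lemma measure_walk_le_of_nearDensity {ν C C' : ℝ} (hν : 0 < ν) (hdrift : E.NoDriftIn ν)
    (hcov : E.CoveringWith ν C C') {pE pO : ℝ} (hp : pE ≤ pO) {ρ ε : ℝ} (hρ : ρ ∈ Set.Ioo a b)
    (hε : ε ∈ Set.Ioo (0 : ℝ) 1) (hρε : ρ + ε ∈ Set.Ioo a b) {l n H H' : ℕ} (hl : 2 ≤ l)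
    (hH : H' + 4 * ν * (l ^ 4 : ℕ) ≤ H) (hH' : ((l ^ 4 : ℕ) : ℝ) + n + 2 * ν * n ≤ H')
    (hνl : 1 < ν ^ 8 * (l ^ 4 : ℕ))
    (hC : C * (ε ^ 2)⁻¹ * (1 + |Real.log (ν * (l ^ 4 : ℕ)) ^ 3|) < ν * l)
    {σ τ : Config} (hσ : NearDensity ρ ε l H σ) (hτ : NearDensity (ρ + ε) ε l H τ)
    (u : ℕ → unitInterval) (c : ℤ) :
    E.P σ {η | c ≤ walkFrom pE pO 0 η u (l ^ 4 + n)} ≤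
      E.P τ {η | c ≤ walkFrom pE pO (2 * (l ^ 4 : ℕ)) η u (l ^ 4 + n)} +
        couplingError ν C' ε l n H := by
  have hroot : ((l ^ 4 : ℕ) : ℝ) ^ (1 / 4 : ℝ) = l := by
    push_cast
    rw [← Real.rpow_natCast, ← Real.rpow_mul (by positivity)]
    norm_num
  have hl4 : 0 < l ^ 4 := by positivity
  have hl4' : (0 : ℝ) < (l ^ 4 : ℕ) := by exact_mod_cast hl4
  have hH'0 : (0 : ℝ) < H' := by
    have : 0 ≤ 2 * ν * n := by positivity
    have : (0 : ℝ) ≤ n := by positivity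
    linarith
  refine E.measure_walk_le_of_cover hp (r := H') (r' := H' - 2 * ν * n) ?_ ?_ (by linarith) u c
  · have hH1 : 4 * ν * (l ^ 4 : ℕ) < H := by linarith
    have hH2 : 1 ≤ H := by
      have : (0 : ℝ) < H := lt_of_le_of_lt (by positivity) hH1
      exact_mod_cast this
    obtain ⟨Q, hQ, hQr⟩ := hcov ρ hρ ε hε hρε H (l ^ 4) hH2 hl4 hH1 hνl (by rwa [hroot]) τ σ (by
      intro y m h1 h2 hsub
      rw [hroot, Nat.floor_natCast] at h1 h2
      have hy : |y| ≤ H := by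
        have : y ∈ Finset.Ico y (y + m) := by
          rw [Finset.mem_Ico]; omega
        exact abs_le.mpr (Finset.mem_Icc.mp (hsub this))
      have h3 := (abs_le.mp (hσ y m hy h1 h2)).2
      have h4 := (abs_le.mp (hτ y m hy h1 h2)).1
      constructor <;> linarith)
    rw [hroot] at hQr
    have := hQ.measure_compl_le (measurableSet_dominatesOn _
      ((measurable_pi_apply _).comp measurable_fst)
      ((measurable_pi_apply _).comp measurable_snd)) hQr
    refine ⟨Q, hQ, (measure_mono (Set.compl_subset_compl.mpr ?_)).trans this⟩
    intro ω hω x hx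
    exact hω x (by linarith)
  · intro ξ ξ' h
    obtain ⟨Q, hQ, hQr⟩ := hdrift n H' 1 le_rfl ξ ξ' h
    have hm : MeasurableSet {ω : EnvPath × EnvPath | ∀ s ≤ n,
        DominatesOn (H' - 2 * ν * (1 : ℕ) * n) (ω.1 s) (ω.2 s)} := by
      simp only [Set.ofPred_forall]
      exact .iInter fun s => .iInter fun _ => measurableSet_dominatesOn _
        ((measurable_pi_apply _).comp measurable_fst) ((measurable_pi_apply _).comp measurable_snd)
    have := hQ.measure_compl_le hm hQr
    refine ⟨Q, hQ, ?_⟩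
    simpa using this

/-- Comparison of a walk block started from a configuration of density near `ρ` with a walk block
in a fresh environment of density `ρ + s ε`, in the direction `s`. -/
lemma measure_block_le {ν C C' : ℝ} (hν : 0 < ν) (hdrift : E.NoDriftIn ν)
    (hcov : E.CoveringWith ν C C') {pE pO : ℝ} (hp : pE ≤ pO) {ρ ε : ℝ} (hρ : ρ ∈ Set.Ioo a b)
    (hε : ε ∈ Set.Ioo (0 : ℝ) 1) {s : ℤ} (hs : s = 1 ∨ s = -1) (hρε : ρ + s * ε ∈ Set.Ioo a b)
    {l n H H' : ℕ} (hl : 2 ≤ l)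
    (hH : H' + 4 * ν * (l ^ 4 : ℕ) ≤ H) (hH' : ((l ^ 4 : ℕ) : ℝ) + n + 2 * ν * n ≤ H')
    (hνl : 1 < ν ^ 8 * (l ^ 4 : ℕ))
    (hC : C * (ε ^ 2)⁻¹ * (1 + |Real.log (ν * (l ^ 4 : ℕ)) ^ 3|) < ν * l)
    {σ : Config} (hσ : NearDensity ρ ε l (H + 2 * l ^ 4) σ)
    (u : ℕ → unitInterval) (c : ℤ) :
    E.P σ {η | c ≤ s * walkFrom pE pO 0 η u (l ^ 4 + n)} ≤
      E.law (ρ + s * ε) {η | c ≤ s * walkFrom pE pO 0 η u (l ^ 4 + n) + 2 * (l ^ 4 : ℕ)} +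
        (couplingError ν C' ε l n H +
          (E.μ (ρ + s * ε) : Measure Config) {τ | NearDensity (ρ + s * ε) ε l H τ}ᶜ) := by
  have hB := (measurableSet_nearDensity (ρ + s * ε) ε l H).compl
  have key (A : Set EnvPath) (hA : MeasurableSet A) (h : ∀ τ, NearDensity (ρ + s * ε) ε l H τ →
      E.P σ {η | c ≤ s * walkFrom pE pO 0 η u (l ^ 4 + n)} ≤
        E.P τ A + couplingError ν C' ε l n H) :
      E.P σ {η | c ≤ s * walkFrom pE pO 0 η u (l ^ 4 + n)} ≤ E.law (ρ + s * ε) A +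
        (couplingError ν C' ε l n H +
          (E.μ (ρ + s * ε) : Measure Config) {τ | NearDensity (ρ + s * ε) ε l H τ}ᶜ) := by
    rw [E.law_apply _ hA, ← add_assoc]
    calc E.P σ {η | c ≤ s * walkFrom pE pO 0 η u (l ^ 4 + n)}
        = ∫⁻ _, E.P σ {η | c ≤ s * walkFrom pE pO 0 η u (l ^ 4 + n)}
          ∂(E.μ (ρ + s * ε) : Measure Config) := by simp
      _ ≤ _ := lintegral_le_lintegral_add_of_subset hB (E.P.measurable_coe hA)
          (fun _ => prob_le_one) (fun τ hτ => h τ (by simpa using hτ))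
  rcases hs with rfl | rfl
  · simp only [Int.cast_one, one_mul] at *
    have h2 := E.law_walkFrom_eq hρε pE pO (2 * (l ^ 4 : ℕ)) u (l ^ 4 + n) (fun z => c ≤ z)
    simp only [add_comm (2 * ((l ^ 4 : ℕ) : ℤ))] at h2
    rw [← h2]
    refine key _ (measurableSet_walkFrom pE pO _ u _ (fun z => c ≤ z)) (fun τ hτ => ?_)
    exact measure_walk_le_of_nearDensity hν hdrift hcov hp hρ hε hρε hl hH hH' hνl hC
      (hσ.mono (by omega)) hτ u c
  -- Now the fresh environment is the sparser one. The comparison is applied with the roles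
  -- exchanged and then turned around by taking complements. The head start goes to the walker in
  -- `σ`, which is why `σ` is translated and its window has the margin `2 * l ^ 4`.
  · simp only [Int.cast_neg, Int.cast_one, neg_mul, one_mul] at *
    refine key _ (measurableSet_walkFrom pE pO _ u _ (fun z => c ≤ -z + 2 * (l ^ 4 : ℕ)))
      (fun τ hτ => ?_)
    have h2 := E.measure_walkFrom_eq σ pE pO (-(2 * (l ^ 4 : ℕ))) (2 * (l ^ 4 : ℕ)) u (l ^ 4 + n)
      (fun z => c ≤ -z)
    rw [neg_add_cancel] at h2
    rw [h2]
    have hσ' : NearDensity ρ ε l H (Config.translate (-(2 * (l ^ 4 : ℕ))) σ) := by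
      refine hσ.translate _ ?_
      rw [abs_neg, abs_of_nonneg (by positivity)]
      push_cast; linarith
    -- The `+ 1` in the threshold makes the complementary integer event `≤ 2 * l ^ 4 - c`.
    have h3 := measure_walk_le_of_nearDensity (C := C) (C' := C') (ρ := ρ + -ε) hν hdrift hcov hp
      hρε hε (by simpa using hρ) hl hH hH' hνl hC hτ (τ := Config.translate (-(2 * (l ^ 4 : ℕ))) σ)
      (by simpa using hσ') u (2 * (l ^ 4 : ℕ) - c + 1)
    have h4 := measure_compl_le_compl_add
      (measurableSet_walkFrom pE pO _ u _ (fun z => 2 * (l ^ 4 : ℕ) - c + 1 ≤ z))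
      (measurableSet_walkFrom pE pO _ u _ (fun z => 2 * (l ^ 4 : ℕ) - c + 1 ≤ z)) h3
    convert h4 using 2
    · congr 1; ext η; simp only [Set.mem_ofPred_eq]; omega
    · congr 1; ext η; simp only [Set.mem_ofPred_eq, Set.mem_compl_iff]; omega

end Environment

/-! ### The annealed law and the replacement of blocks by independent ones. -/

/-- The law of the i.i.d. uniform variables. -/
noncomputable abbrev uniformLaw : Measure (ℕ → unitInterval) :=
  Measure.infinitePi (fun _ : ℕ => (volume : Measure unitInterval))

instance (Q : Measure EnvPath) [IsProbabilityMeasure Q] : IsProbabilityMeasure (annealed Q) := by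
  unfold annealed; infer_instance

section
variable (Q : Measure EnvPath) [IsProbabilityMeasure Q]

lemma lintegral_annealed {f : EnvPath × (ℕ → unitInterval) → ℝ≥0∞} (hf : Measurable f) :
    ∫⁻ ω, f ω ∂(annealed Q) = ∫⁻ u, ∫⁻ η, f (η, u) ∂Q ∂uniformLaw :=
  lintegral_prod_symm _ hf.aemeasurable

lemma annealed_apply {A : Set (EnvPath × (ℕ → unitInterval))} (hA : MeasurableSet A) :
    annealed Q A = ∫⁻ u, Q {η | (η, u) ∈ A} ∂uniformLaw :=
  Measure.prod_apply_symm hA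

lemma measurableSet_annealed_walk (pE pO : ℝ) (n : ℕ) (p : ℤ → Prop) :
    MeasurableSet {ω : EnvPath × (ℕ → unitInterval) | p (walkFrom pE pO 0 ω.1 ω.2 n)} :=
  (measurable_walkFrom pE pO n measurable_const measurable_fst measurable_snd)
    (MeasurableSet.of_discrete (s := {z | p z}))

end

lemma lintegral_uniformLaw_concat (s : ℕ) {f : (ℕ → unitInterval) → ℝ≥0∞} (hf : Measurable f) :
    ∫⁻ u, f u ∂uniformLaw = ∫⁻ u, ∫⁻ v, f (concatAt s u v) ∂uniformLaw ∂uniformLaw := by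
  nth_rewrite 1 [uniformLaw, ← map_concatAt (volume : Measure unitInterval) s]
  rw [lintegral_map hf (measurable_concatAt s)]
  exact lintegral_prod _ (hf.comp (measurable_concatAt s)).aemeasurable

namespace Environment

variable {a b : ℝ} (E : Environment a b)

/-- Only the last block is replaced; the first `K` steps stay in the original environment. By
stationarity the bad event at time `K` costs its `μ ρ`-probability, and no decoupling from the walk
is needed. Since `|X_K| ≤ K`, a window `R + K` around the origin contains a window `R` around the
walker. -/
lemma annealed_walk_add_le {pE pO : ℝ} {ρ ρ' ε : ℝ} (hρ : ρ ∈ Set.Ioo a b) {s : ℤ}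
    {l L R K r : ℕ} {d : ℤ} {e : ℝ≥0∞}
    (hblock : ∀ σ, NearDensity ρ ε l R σ → ∀ u c, E.P σ {η | c ≤ s * walkFrom pE pO 0 η u L} ≤
      E.law ρ' {η | c ≤ s * walkFrom pE pO 0 η u L + d} + e) (hr : R + K ≤ r) (c : ℤ) :
    annealed (E.law ρ) {ω | c ≤ s * walkFrom pE pO 0 ω.1 ω.2 (K + L)} ≤
      ∫⁻ ω, annealed (E.law ρ) {ω' | c - s * walkFrom pE pO 0 ω.1 ω.2 L - d ≤
        s * walkFrom pE pO 0 ω'.1 ω'.2 K} ∂(annealed (E.law ρ')) +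
      (e + (E.μ ρ : Measure Config) {σ | NearDensity ρ ε l r σ}ᶜ) := by
  set G : (ℕ → unitInterval) → ℤ → ℝ≥0∞ := fun v c =>
    E.law ρ' {η | c ≤ s * walkFrom pE pO 0 η v L + d} with hG
  set B : Set Config := {σ | NearDensity ρ ε l r σ}ᶜ with hB
  have hBm : MeasurableSet B := (measurableSet_nearDensity ρ ε l r).compl
  set S : Set ((EnvPath × (ℕ → unitInterval)) × (EnvPath × (ℕ → unitInterval))) :=
    {p | c ≤ s * walkFrom pE pO 0 p.1.1 p.1.2 K + (s * walkFrom pE pO 0 p.2.1 p.2.2 L + d)} with hS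
  have hSm : MeasurableSet S := by
    refine measurableSet_le measurable_const ?_
    have h1 : Measurable (fun p : (EnvPath × (ℕ → unitInterval)) × (EnvPath × (ℕ → unitInterval)) =>
        walkFrom pE pO 0 p.1.1 p.1.2 K) := by fun_prop
    have h2 : Measurable (fun p : (EnvPath × (ℕ → unitInterval)) × (EnvPath × (ℕ → unitInterval)) =>
        walkFrom pE pO 0 p.2.1 p.2.2 L) := by fun_prop
    exact (h1.const_mul s).add ((h2.const_mul s).add_const d)
  have hGm {α : Type} [MeasurableSpace α] {f : α → ℕ → unitInterval} {g : α → ℤ}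
      (hf : Measurable f) (hg : Measurable g) : Measurable (fun x => G (f x) (g x)) := by
    have : MeasurableSet {p : α × EnvPath | g p.1 ≤ s * walkFrom pE pO 0 p.2 (f p.1) L + d} := by
      refine measurableSet_le (hg.comp measurable_fst) ?_
      exact ((measurable_walkFrom pE pO L measurable_const measurable_snd
        (hf.comp measurable_fst)).const_mul s).add_const d
    exact measurable_measure_prodMk_left this
  have hW : Measurable (fun p : EnvPath × (ℕ → unitInterval) => walkFrom pE pO 0 p.1 p.2 K) := by
    fun_prop
  have hW' (u : ℕ → unitInterval) : Measurable (fun η : EnvPath => walkFrom pE pO 0 η u K) := by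
    fun_prop
  have step (u : ℕ → unitInterval) : E.law ρ {η | c ≤ s * walkFrom pE pO 0 η u (K + L)} ≤
      ∫⁻ η, G (fun k => u (K + k)) (c - s * walkFrom pE pO 0 η u K) ∂(E.law ρ) +
        (e + (E.μ ρ : Measure Config) B) := by
    rw [E.law_walkFrom_add ρ pE pO 0 u K L (fun z => c ≤ s * z), ← E.law_apply_time hρ K hBm,
      ← add_assoc]
    refine lintegral_le_lintegral_add_of_subset (measurableSet_time K hBm)
      (hGm measurable_const (((hW' u).const_mul s).const_sub c)) (fun _ => prob_le_one)
      (fun η hη => ?_)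
    have hη' : NearDensity ρ ε l r (η K) := by simpa [hB] using hη
    set x := walkFrom pE pO 0 η u K with hx
    have hxK : |x| ≤ K := by simpa using abs_walkFrom_sub_le pE pO 0 η u K
    have h1 := E.measure_walkFrom_eq (η K) pE pO x 0 (fun k => u (K + k)) L (fun z => c ≤ s * z)
    rw [add_zero] at h1
    rw [h1]
    have h2 := hblock (Config.translate x (η K)) (hη'.translate x (by omega))
      (fun k => u (K + k)) (c - s * x)
    refine le_trans (le_of_eq ?_) h2
    congr 1; ext ζ; simp only [Set.mem_ofPred_eq, mul_add]
    constructor <;> intro h <;> linarith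
  -- Splitting the uniforms at time `K` makes the fresh block independent of the first `K` steps, so
  -- the bound becomes a product measure, which can be integrated in either order.
  have eq1 : ∫⁻ u, ∫⁻ η, G (fun k => u (K + k)) (c - s * walkFrom pE pO 0 η u K) ∂(E.law ρ)
      ∂uniformLaw = ((annealed (E.law ρ)).prod (annealed (E.law ρ'))) S := by
    have m1 : Measurable (fun p : (ℕ → unitInterval) × EnvPath =>
        G (fun k => p.1 (K + k)) (c - s * walkFrom pE pO 0 p.2 p.1 K)) := by
      refine hGm (by fun_prop) ?_
      exact ((hW.comp (measurable_snd.prodMk measurable_fst)).const_mul s).const_sub c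
    rw [lintegral_uniformLaw_concat K m1.lintegral_prod_right', Measure.prod_apply hSm,
      lintegral_annealed _ (measurable_measure_prodMk_left hSm)]
    refine lintegral_congr (fun u => ?_)
    have e1 (v : ℕ → unitInterval) (η : EnvPath) :
        walkFrom pE pO 0 η (concatAt K u v) K = walkFrom pE pO 0 η u K :=
      walkFrom_congr pE pO 0 (fun _ _ => rfl) (fun k hk => by simp [concatAt, hk])
    simp only [concatAt_add, e1]
    have m2 : Measurable (fun p : (ℕ → unitInterval) × EnvPath =>
        G p.1 (c - s * walkFrom pE pO 0 p.2 u K)) :=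
      hGm measurable_fst ((((hW' u).comp measurable_snd).const_mul s).const_sub c)
    rw [lintegral_lintegral_swap m2.aemeasurable]
    refine lintegral_congr (fun η => ?_)
    rw [annealed_apply _ (measurable_prodMk_left hSm)]
    refine lintegral_congr (fun v => ?_)
    simp only [hG, hS]
    congr 1; ext ζ
    simp only [Set.mem_ofPred_eq, Set.mem_preimage]
    constructor <;> intro h <;> linarith
  have eq2 : ((annealed (E.law ρ)).prod (annealed (E.law ρ'))) S =
      ∫⁻ ω, annealed (E.law ρ) {ω' | c - s * walkFrom pE pO 0 ω.1 ω.2 L - d ≤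
        s * walkFrom pE pO 0 ω'.1 ω'.2 K} ∂(annealed (E.law ρ')) := by
    rw [Measure.prod_apply_symm hSm]
    refine lintegral_congr (fun ω => ?_)
    congr 1; ext ω'
    simp only [hS, Set.mem_ofPred_eq, Set.mem_preimage]
    constructor <;> intro h <;> linarith
  rw [annealed_apply _ (measurableSet_annealed_walk pE pO (K + L) (fun z => c ≤ s * z))]
  calc ∫⁻ u, E.law ρ {η | c ≤ s * walkFrom pE pO 0 η u (K + L)} ∂uniformLaw
      ≤ ∫⁻ u, (∫⁻ η, G (fun k => u (K + k)) (c - s * walkFrom pE pO 0 η u K) ∂(E.law ρ) +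
        (e + (E.μ ρ : Measure Config) B)) ∂uniformLaw := lintegral_mono step
    _ = _ := by
        rw [lintegral_add_right _ measurable_const, eq1, eq2, lintegral_const]
        simp

/-- Exponential bound for the walk after `m` blocks, by comparison with independent blocks. -/
lemma annealed_walk_mul_le {pE pO : ℝ} {ρ ρ' ε : ℝ} (hρ : ρ ∈ Set.Ioo a b) {s : ℤ}
    {l L R r N : ℕ} {d : ℤ} {e : ℝ≥0∞}
    (hblock : ∀ σ, NearDensity ρ ε l R σ → ∀ u c, E.P σ {η | c ≤ s * walkFrom pE pO 0 η u L} ≤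
      E.law ρ' {η | c ≤ s * walkFrom pE pO 0 η u L + d} + e) (hr : R + N * L ≤ r)
    {lam : ℝ} (hlam : 0 ≤ lam) {m : ℕ} (hm : m ≤ N) (c : ℤ) :
    annealed (E.law ρ) {ω | c ≤ s * walkFrom pE pO 0 ω.1 ω.2 (m * L)} ≤
      ENNReal.ofReal (Real.exp (-(lam * c))) *
        (∫⁻ ω, ENNReal.ofReal (Real.exp (lam * (s * walkFrom pE pO 0 ω.1 ω.2 L + d)))
          ∂(annealed (E.law ρ'))) ^ m +
      m * (e + (E.μ ρ : Measure Config) {σ | NearDensity ρ ε l r σ}ᶜ) := by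
  set M := ∫⁻ ω, ENNReal.ofReal (Real.exp (lam * (s * walkFrom pE pO 0 ω.1 ω.2 L + d)))
    ∂(annealed (E.law ρ')) with hM
  set e' := e + (E.μ ρ : Measure Config) {σ | NearDensity ρ ε l r σ}ᶜ with he'
  have hmeas : Measurable (fun ω : EnvPath × (ℕ → unitInterval) =>
      ENNReal.ofReal (Real.exp (lam * (s * walkFrom pE pO 0 ω.1 ω.2 L + d)))) := by
    have : Measurable (fun ω : EnvPath × (ℕ → unitInterval) => walkFrom pE pO 0 ω.1 ω.2 L) := by
      fun_prop
    exact (measurable_from_top (f := fun z : ℤ =>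
      ENNReal.ofReal (Real.exp (lam * (s * z + d))))).comp this
  induction m generalizing c with
  | zero =>
    simp only [zero_mul, walkFrom_zero, mul_zero, pow_zero, mul_one, Nat.cast_zero, add_zero]
    by_cases hc : c ≤ 0
    · refine prob_le_one.trans ?_
      rw [← ENNReal.ofReal_one]
      refine ENNReal.ofReal_le_ofReal (Real.one_le_exp ?_)
      have : (c : ℝ) ≤ 0 := by exact_mod_cast hc
      nlinarith
    · simp [hc]
  | succ m ih =>
    have hK : R + m * L ≤ r := by
      have : m * L ≤ N * L := Nat.mul_le_mul_right _ (by omega)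
      omega
    rw [add_mul, one_mul]
    refine (E.annealed_walk_add_le hρ hblock hK c).trans ?_
    -- The induction hypothesis is used at the random level left over by the last block; the shift
    -- of level factors out of the exponential and integrates to one more factor `M`.
    calc _ ≤ ∫⁻ ω, (ENNReal.ofReal (Real.exp (-(lam * c))) * M ^ m *
          ENNReal.ofReal (Real.exp (lam * (s * walkFrom pE pO 0 ω.1 ω.2 L + d))) + m * e')
            ∂(annealed (E.law ρ')) + e' := by
          gcongr with ω
          refine (ih (by omega) _).trans (le_of_eq ?_)
          rw [mul_right_comm, ← ENNReal.ofReal_mul (by positivity), ← Real.exp_add]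
          congr 4
          push_cast; ring
      _ = _ := by
          rw [lintegral_add_right _ measurable_const, lintegral_const_mul _ hmeas, lintegral_const,
            ← hM]
          simp only [measure_univ, mul_one]
          push_cast; ring

end Environment

/-! ### Exponential moments of one block. -/

section
variable (Q : Measure EnvPath) [IsProbabilityMeasure Q] (pE pO : ℝ)

lemma measurable_walkFrom_real (n : ℕ) : Measurable
    (fun ω : EnvPath × (ℕ → unitInterval) => (walkFrom pE pO 0 ω.1 ω.2 n : ℝ)) := by
  have : Measurable (fun ω : EnvPath × (ℕ → unitInterval) => walkFrom pE pO 0 ω.1 ω.2 n) := by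
    fun_prop
  exact (measurable_from_top (f := fun z : ℤ => (z : ℝ))).comp this

lemma abs_walkFrom_le (η : EnvPath) (u : ℕ → unitInterval) (n : ℕ) :
    |(walkFrom pE pO 0 η u n : ℝ)| ≤ n := by
  have := abs_walkFrom_sub_le pE pO 0 η u n
  rw [sub_zero] at this
  exact_mod_cast this

lemma integrable_walkFrom (n : ℕ) :
    Integrable (fun ω => (walkFrom pE pO 0 ω.1 ω.2 n : ℝ)) (annealed Q) :=
  Integrable.of_bound (measurable_walkFrom_real pE pO n).aestronglyMeasurable n
    (ae_of_all _ fun ω => abs_walkFrom_le pE pO ω.1 ω.2 n)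

/-- Hoeffding's lemma: the walk after `n` steps lies in `[-n, n]`, so its centred version is
sub-Gaussian with variance proxy `n ^ 2`. -/
lemma lintegral_exp_walkFrom_le {s : ℤ} (hs : s = 1 ∨ s = -1) (n : ℕ) (d lam : ℝ) :
    ∫⁻ ω, ENNReal.ofReal (Real.exp (lam * (s * walkFrom pE pO 0 ω.1 ω.2 n + d))) ∂(annealed Q) ≤
      ENNReal.ofReal (Real.exp (lam * (s * (∫ ω, (walkFrom pE pO 0 ω.1 ω.2 n : ℝ) ∂(annealed Q)) + d)
        + n ^ 2 * lam ^ 2 / 2)) := by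
  set X : EnvPath × (ℕ → unitInterval) → ℝ := fun ω => s * walkFrom pE pO 0 ω.1 ω.2 n with hX
  have hXm : Measurable X := (measurable_walkFrom_real pE pO n).const_mul _
  have hXb : ∀ᵐ ω ∂(annealed Q), X ω ∈ Set.Icc (-(n : ℝ)) n := by
    refine ae_of_all _ fun ω => abs_le.mp ?_
    have h1 : |(s : ℝ)| = 1 := by rcases hs with rfl | rfl <;> simp
    rw [hX]
    simp only [abs_mul, h1, one_mul]
    exact abs_walkFrom_le pE pO ω.1 ω.2 n
  have hint : (annealed Q)[X] = s * ∫ ω, (walkFrom pE pO 0 ω.1 ω.2 n : ℝ) ∂(annealed Q) :=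
    integral_const_mul _ _
  have h := hasSubgaussianMGF_of_mem_Icc hXm.aemeasurable hXb
  have hmgf := h.mgf_le lam
  have hi := h.integrable_exp_mul lam
  have hc : (((‖(n : ℝ) - -n‖₊ / 2) ^ 2 : NNReal) : ℝ) = (n : ℝ) ^ 2 := by
    have : (0 : ℝ) ≤ n := by positivity
    push_cast
    rw [Real.norm_of_nonneg (by linarith)]
    ring
  rw [hc] at hmgf
  have heq (ω : EnvPath × (ℕ → unitInterval)) :
      Real.exp (lam * (s * walkFrom pE pO 0 ω.1 ω.2 n + d)) =
        Real.exp (lam * ((annealed Q)[X] + d)) * Real.exp (lam * (X ω - (annealed Q)[X])) := by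
    rw [← Real.exp_add, hX]; congr 1; ring
  simp only [heq]
  rw [← ofReal_integral_eq_lintegral_ofReal (hi.const_mul _) (ae_of_all _ fun ω => by positivity),
    integral_const_mul, ← hint, Real.exp_add]
  refine ENNReal.ofReal_le_ofReal ?_
  gcongr
  exact hmgf

end

/-! ### Finite-range speed and Gaussian deviations over many blocks. -/

namespace Environment

variable {a b : ℝ} (E : Environment a b)

/-- The first `L` steps see only the zeroth independent copy, since the next resampling takes place
at time `L`. -/
lemma integral_walkFrom_eq (pE pO ρ : ℝ) (L : ℕ) :
    ∫ ω, (walkFrom pE pO 0 ω.1 ω.2 L : ℝ) ∂(annealed (E.law ρ)) =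
      L * E.finiteRangeSpeed pE pO ρ L := by
  have hg : Measurable (fun (ω : ℕ → EnvPath) (t : ℕ) => ω (t / L) (t % L)) :=
    measurable_pi_lambda _ (fun t => (measurable_pi_apply (t % L)).comp
      (measurable_pi_apply (t / L)))
  have : IsProbabilityMeasure (E.finiteRangeLaw ρ L) :=
    Measure.isProbabilityMeasure_map hg.aemeasurable
  have hI (Q : Measure EnvPath) [IsProbabilityMeasure Q] :
      ∫ ω, (walkFrom pE pO 0 ω.1 ω.2 L : ℝ) ∂(annealed Q) =
        ∫ u, ∫ η, (walkFrom pE pO 0 η u L : ℝ) ∂Q ∂uniformLaw :=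
    integral_prod_symm _ (integrable_walkFrom Q pE pO L)
  have hm (u : ℕ → unitInterval) : Measurable (fun η => (walkFrom pE pO 0 η u L : ℝ)) :=
    (measurable_walkFrom_real pE pO L).comp (measurable_id.prodMk measurable_const)
  unfold finiteRangeSpeed
  rw [integral_div]
  simp only [walk_eq_walkFrom]
  rcases Nat.eq_zero_or_pos L with rfl | hL
  · simp
  rw [mul_div_cancel₀ _ (by positivity), hI, hI]
  refine integral_congr_ae (ae_of_all _ fun u => ?_)
  simp only [finiteRangeLaw]
  rw [integral_map hg.aemeasurable (hm u).aestronglyMeasurable]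
  have h1 (ω : ℕ → EnvPath) : walkFrom pE pO 0 (fun t => ω (t / L) (t % L)) u L =
      walkFrom pE pO 0 (ω 0) u L :=
    walkFrom_congr pE pO 0 (fun k hk => by rw [Nat.div_eq_of_lt hk, Nat.mod_eq_of_lt hk])
      (fun _ _ => rfl)
  simp only [h1]
  rw [← integral_map (φ := fun ω : ℕ → EnvPath => ω 0) (measurable_pi_apply 0).aemeasurable
    (hm u).aestronglyMeasurable]
  congr 1
  exact (Measure.infinitePi_map_eval (fun _ : ℕ => E.law ρ) 0).symm

lemma abs_finiteRangeSpeed_le (pE pO ρ : ℝ) (L : ℕ) : |E.finiteRangeSpeed pE pO ρ L| ≤ 1 := by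
  rcases Nat.eq_zero_or_pos L with rfl | hL
  · simp [finiteRangeSpeed]
  have hL' : (0 : ℝ) < L := by exact_mod_cast hL
  have h := norm_integral_le_of_norm_le_const (μ := annealed (E.law ρ)) (C := L)
    (f := fun ω => (walkFrom pE pO 0 ω.1 ω.2 L : ℝ))
    (ae_of_all _ fun ω => abs_walkFrom_le pE pO ω.1 ω.2 L)
  rw [E.integral_walkFrom_eq, Real.norm_eq_abs, abs_mul, abs_of_pos hL', probReal_univ, mul_one]
    at h
  exact (mul_le_iff_le_one_right hL').mp h

/-- Gaussian bound for the deviations of the walk after `m` blocks. -/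
lemma annealed_deviation_le {pE pO : ℝ} {ρ ρ' ε : ℝ} (hρ : ρ ∈ Set.Ioo a b) {s : ℤ}
    (hs : s = 1 ∨ s = -1) {l L R r m : ℕ} {d : ℤ} {e : ℝ≥0∞}
    (hblock : ∀ σ, NearDensity ρ ε l R σ → ∀ u c, E.P σ {η | c ≤ s * walkFrom pE pO 0 η u L} ≤
      E.law ρ' {η | c ≤ s * walkFrom pE pO 0 η u L + d} + e) (hr : R + m * L ≤ r)
    {x : ℝ} (hx : 0 ≤ x)
    (he : e + (E.μ ρ : Measure Config) {σ | NearDensity ρ ε l r σ}ᶜ ≤ ENNReal.ofReal x)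
    (hm : 1 ≤ m) (hL : 1 ≤ L) {y : ℝ} (hy : 0 ≤ y) :
    (annealed (E.law ρ)).real {ω | m * (s * (L * E.finiteRangeSpeed pE pO ρ' L) + d) + y ≤
      s * walkFrom pE pO 0 ω.1 ω.2 (m * L)} ≤
      Real.exp (-(y ^ 2 / (2 * m * L ^ 2))) + m * x := by
  set V := L * E.finiteRangeSpeed pE pO ρ' L with hV
  set A : ℝ := m * (s * V + d) + y with hA
  have hm' : (0 : ℝ) < m := by exact_mod_cast hm
  have hL' : (0 : ℝ) < L := by exact_mod_cast hL
  -- The minimiser of `-lam * y + m * L ^ 2 * lam ^ 2 / 2`.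
  set lam : ℝ := y / (m * L ^ 2) with hlam
  have hlam0 : 0 ≤ lam := by positivity
  have hset : {ω : EnvPath × (ℕ → unitInterval) | A ≤ s * walkFrom pE pO 0 ω.1 ω.2 (m * L)} =
      {ω | ⌈A⌉ ≤ s * walkFrom pE pO 0 ω.1 ω.2 (m * L)} := by
    ext ω
    simp only [Set.mem_ofPred_eq, Int.ceil_le]
    push_cast; rfl
  have h := E.annealed_walk_mul_le hρ hblock hr hlam0 le_rfl ⌈A⌉
  have hM := lintegral_exp_walkFrom_le (E.law ρ') pE pO hs L d lam
  rw [E.integral_walkFrom_eq, ← hV] at hM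
  have h2 : annealed (E.law ρ) {ω | ⌈A⌉ ≤ s * walkFrom pE pO 0 ω.1 ω.2 (m * L)} ≤
      ENNReal.ofReal (Real.exp (-(y ^ 2 / (2 * m * L ^ 2))) + m * x) := by
    refine h.trans ?_
    rw [ENNReal.ofReal_add (by positivity) (by positivity), ENNReal.ofReal_mul (by positivity),
      ENNReal.ofReal_natCast]
    refine add_le_add ?_ (by gcongr)
    calc _ ≤ ENNReal.ofReal (Real.exp (-(lam * A))) *
          ENNReal.ofReal (Real.exp (lam * (s * V + d) + L ^ 2 * lam ^ 2 / 2)) ^ m := by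
          gcongr
          exact Int.le_ceil A
      _ = ENNReal.ofReal (Real.exp (-(y ^ 2 / (2 * m * L ^ 2)))) := by
          rw [← ENNReal.ofReal_pow (by positivity), ← ENNReal.ofReal_mul (by positivity),
            ← Real.exp_nat_mul, ← Real.exp_add]
          congr 2
          rw [hA, hlam]
          field_simp
          ring
      _ ≤ _ := le_rfl
  rw [hset, Measure.real]
  exact ENNReal.toReal_le_of_le_ofReal (by positivity) h2

end Environment

/-! ### Choice of the scales -/

/-- The factor `2 * √l` stands for the largest admissible `ε⁻²`. The cubed logarithm is `o(y ^
(1/16))` with `y = ν l ^ 4`, so the left side is of order at most `l ^ (3/4)`. -/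
lemma eventually_log_cube_lt {ν : ℝ} (hν : 0 < ν) (C : ℝ) :
    ∀ᶠ l : ℕ in atTop, C * (2 * √l) * (1 + |Real.log (ν * (l ^ 4 : ℕ)) ^ 3|) < ν * l := by
  have h1 : (fun y : ℝ => 1 + |Real.log y ^ 3|) =o[atTop] fun y => y ^ (1 / 16 : ℝ) := by
    refine Asymptotics.IsLittleO.add ?_ ?_
    · exact Asymptotics.isLittleO_const_left.mpr (Or.inr (tendsto_norm_atTop_atTop.comp
        (tendsto_rpow_atTop (by norm_num))))
    · have := isLittleO_log_rpow_rpow_atTop (s := 1 / 16) 3 (by norm_num)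
      refine (this.abs_left).congr' ?_ EventuallyEq.rfl
      filter_upwards with y
      rw [← Real.rpow_natCast]; norm_num
  have hy : Tendsto (fun l : ℕ => ν * ((l ^ 4 : ℕ) : ℝ)) atTop atTop := by
    refine Tendsto.const_mul_atTop hν (tendsto_natCast_atTop_atTop.comp ?_)
    exact tendsto_pow_atTop (by norm_num)
  set c : ℝ := ν / (2 * (|C| + 1) * 2 * ν ^ (1 / 16 : ℝ)) with hc
  have hνp : 0 < ν ^ (1 / 16 : ℝ) := by positivity
  have hc0 : 0 < c := by positivity
  have h2 := hy.eventually (h1.bound hc0)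
  filter_upwards [h2, eventually_ge_atTop 1] with l hl hl1
  have hl0 : (1 : ℝ) ≤ l := by exact_mod_cast hl1
  rw [Real.norm_of_nonneg (by positivity), Real.norm_of_nonneg (by positivity)] at hl
  have h3 : (ν * ((l ^ 4 : ℕ) : ℝ)) ^ (1 / 16 : ℝ) = ν ^ (1 / 16 : ℝ) * (l : ℝ) ^ (1 / 4 : ℝ) := by
    rw [Real.mul_rpow hν.le (by positivity)]
    push_cast
    rw [← Real.rpow_natCast, ← Real.rpow_mul (by positivity)]
    norm_num
  have h4 : √(l : ℝ) * (l : ℝ) ^ (1 / 4 : ℝ) ≤ l := by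
    rw [Real.sqrt_eq_rpow, ← Real.rpow_add (by positivity)]
    calc (l : ℝ) ^ ((1 / 2 : ℝ) + 1 / 4) ≤ (l : ℝ) ^ (1 : ℝ) :=
          Real.rpow_le_rpow_of_exponent_le hl0 (by norm_num)
      _ = l := Real.rpow_one _
  rw [h3] at hl
  calc C * (2 * √l) * (1 + |Real.log (ν * (l ^ 4 : ℕ)) ^ 3|)
      ≤ (|C| + 1) * (2 * √l) * (c * (ν ^ (1 / 16 : ℝ) * (l : ℝ) ^ (1 / 4 : ℝ))) := by
        gcongr
        linarith [le_abs_self C]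
    _ = ν / 2 * (√(l : ℝ) * (l : ℝ) ^ (1 / 4 : ℝ)) := by
        rw [hc]; field_simp
    _ ≤ ν / 2 * l := by gcongr
    _ < ν * l := by
        have : 0 < ν * l := by positivity
        linarith

/-- With `z = l ^ (1/8)` the claim reads `K z ^ 96 exp (-κ z ^ 4) ≤ exp (-2 z)`; eventually `κ z ^ 4
≥ 3 z`, and the spare `exp (-z)` absorbs the polynomial. -/
lemma eventually_pow_mul_exp_le (K : ℝ) {κ : ℝ} (hκ : 0 < κ) :
    ∀ᶠ l : ℕ in atTop, K * (l : ℝ) ^ 12 * Real.exp (-(κ * √l)) ≤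
      Real.exp (-(2 * (l : ℝ) ^ (1 / 8 : ℝ))) := by
  have hz : Tendsto (fun l : ℕ => (l : ℝ) ^ (1 / 8 : ℝ)) atTop atTop :=
    (tendsto_rpow_atTop (by norm_num)).comp tendsto_natCast_atTop_atTop
  have h1 : ∀ᶠ z : ℝ in atTop, K * z ^ 96 * Real.exp (-(κ * z ^ 4)) ≤ Real.exp (-(2 * z)) := by
    have h2 := (Real.tendsto_pow_mul_exp_neg_atTop_nhds_zero 96).const_mul (|K|)
    rw [mul_zero] at h2
    filter_upwards [h2.eventually_le_const zero_lt_one, eventually_ge_atTop 1,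
      eventually_ge_atTop (3 / κ)] with z h3 h4 h5
    have h6 : 3 ≤ κ * z := by rw [div_le_iff₀ hκ] at h5; linarith
    have h7 : 3 * z ≤ κ * z ^ 4 := by
      have : z ≤ z ^ 3 := le_self_pow₀ h4 (by norm_num)
      calc 3 * z ≤ 3 * z ^ 3 := by linarith
        _ ≤ (κ * z) * z ^ 3 := by gcongr
        _ = κ * z ^ 4 := by ring
    calc K * z ^ 96 * Real.exp (-(κ * z ^ 4)) ≤ |K| * z ^ 96 * Real.exp (-z + -(2 * z)) := by
          gcongr
          · exact le_abs_self K
          · linarith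
      _ = (|K| * (z ^ 96 * Real.exp (-z))) * Real.exp (-(2 * z)) := by rw [Real.exp_add]; ring
      _ ≤ 1 * Real.exp (-(2 * z)) := by gcongr
      _ = _ := one_mul _
  filter_upwards [hz.eventually h1] with l hl
  have e1 : ((l : ℝ) ^ (1 / 8 : ℝ)) ^ 96 = (l : ℝ) ^ 12 := by
    rw [← Real.rpow_natCast, ← Real.rpow_mul (by positivity), ← Real.rpow_natCast]; norm_num
  have e2 : ((l : ℝ) ^ (1 / 8 : ℝ)) ^ 4 = √l := by
    rw [← Real.rpow_natCast, ← Real.rpow_mul (by positivity), Real.sqrt_eq_rpow]; norm_num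
  rwa [e1, e2] at hl

namespace Environment

variable {a b : ℝ} {E : Environment a b}

/-- All the errors made in the comparison of `m` blocks are small if the scale `l` of the
empirical densities is large. -/
lemma eventually_error_le {ν C' c : ℝ} (hν : 0 < ν) (hC' : 0 < C') (hc : 0 < c)
    (hd : E.DensityWith c) :
    ∀ᶠ l : ℕ in atTop, ∀ {n H r m : ℕ} {ρ ρ' ε : ℝ}, ρ ∈ Set.Ioo a b → ρ' ∈ Set.Ioo a b →
      ε ∈ Set.Ioo (0 : ℝ) 1 → (2 * √l)⁻¹ ≤ ε ^ 2 → l ≤ n → H ≤ r → 1 ≤ m →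
      r ≤ (6 * ν + 6) * m * (256 * (l : ℝ) ^ 8) → (H : ℝ) ≤ (6 * ν + 6) * (256 * (l : ℝ) ^ 8) →
      couplingError ν C' ε l n H + (E.μ ρ' : Measure Config) {σ | NearDensity ρ' ε l H σ}ᶜ +
        (E.μ ρ : Measure Config) {σ | NearDensity ρ ε l r σ}ᶜ ≤
      ENNReal.ofReal (m * Real.exp (-(2 * (l : ℝ) ^ (1 / 8 : ℝ)))) := by
  -- One entry for each error: drift, covering, density. The last two use `ε ^ 2 * l ≥ √l / 2`, and
  -- `96 = 16 * 3 * 2` combines `(ε / 4) ^ 2`, `l / 2 ≥ l / 3` (natural division) and this bound.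
  set κ : ℝ := min (ν / 4) (min ((C' * (1 + ν⁻¹))⁻¹ / 2) (c / 96)) with hκ
  have hκ0 : 0 < κ := by positivity
  have hκ1 : κ ≤ ν / 4 := min_le_left _ _
  have hκ2 : κ ≤ (C' * (1 + ν⁻¹))⁻¹ / 2 := (min_le_right _ _).trans (min_le_left _ _)
  have hκ3 : κ ≤ c / 96 := (min_le_right _ _).trans (min_le_right _ _)
  set B : ℝ := (6 * ν + 6) * 256 with hB
  set K : ℝ := 20 + C' * B + 2 * ((2 * B + 1) * 2 * 2) with hK
  filter_upwards [eventually_pow_mul_exp_le K hκ0, eventually_ge_atTop 2] with l hl hl2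
  intro n H r m ρ ρ' ε hρ hρ' hε hε2 hn hHr hm hr hH
  have hl1 : (1 : ℝ) ≤ l := by exact_mod_cast (by omega : 1 ≤ l)
  have hm1 : (1 : ℝ) ≤ m := by exact_mod_cast hm
  have hB0 : 0 < B := by positivity
  have hsq : √(l : ℝ) ≤ l := by
    rw [Real.sqrt_le_left (by positivity)]; nlinarith
  have hs0 : 0 < √(l : ℝ) := by positivity
  have hel : √(l : ℝ) / 2 ≤ ε ^ 2 * l := by
    calc √(l : ℝ) / 2 = (2 * √l)⁻¹ * l := by
          field_simp; rw [Real.sq_sqrt (by positivity)]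
      _ ≤ _ := by gcongr
  have hpow8 : (l : ℝ) ^ 8 ≤ (l : ℝ) ^ 12 := pow_le_pow_right₀ hl1 (by norm_num)
  have b1 : 20 * Real.exp (-(ν * n / 4)) ≤ m * (20 * (l : ℝ) ^ 12 * Real.exp (-(κ * √l))) := by
    have h1 : κ * √l ≤ ν * n / 4 := by
      have : (l : ℝ) ≤ n := by exact_mod_cast hn
      calc κ * √l ≤ ν / 4 * n := by gcongr; linarith
        _ = _ := by ring
    have h2 : (1 : ℝ) ≤ (l : ℝ) ^ 12 := one_le_pow₀ hl1
    calc 20 * Real.exp (-(ν * n / 4)) ≤ 1 * (20 * 1 * Real.exp (-(κ * √l))) := by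
          rw [one_mul, mul_one]; gcongr
      _ ≤ _ := by gcongr
  have b2 : C' * (l ^ 4 : ℕ) * H * Real.exp (-((C' * (1 + ν⁻¹))⁻¹ * ε ^ 2 * l)) ≤
      m * (C' * B * (l : ℝ) ^ 12 * Real.exp (-(κ * √l))) := by
    have h1 : κ * √l ≤ (C' * (1 + ν⁻¹))⁻¹ * ε ^ 2 * l := by
      calc κ * √l ≤ (C' * (1 + ν⁻¹))⁻¹ / 2 * √l := by gcongr
        _ = (C' * (1 + ν⁻¹))⁻¹ * (√l / 2) := by ring
        _ ≤ (C' * (1 + ν⁻¹))⁻¹ * (ε ^ 2 * l) := by gcongr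
        _ = _ := by ring
    calc C' * (l ^ 4 : ℕ) * H * Real.exp (-((C' * (1 + ν⁻¹))⁻¹ * ε ^ 2 * l))
        ≤ C' * (l ^ 4 : ℕ) * ((6 * ν + 6) * (256 * (l : ℝ) ^ 8)) * Real.exp (-(κ * √l)) := by
          gcongr
      _ = 1 * (C' * B * (l : ℝ) ^ 12 * Real.exp (-(κ * √l))) := by
          rw [hB]; push_cast; ring
      _ ≤ _ := by gcongr
  have b3 (r : ℕ) (hr : r ≤ (6 * ν + 6) * m * (256 * (l : ℝ) ^ 8)) :
      (2 * r + 1) * (l + 1) * (2 * Real.exp (-(c * (ε / 4) ^ 2 * (l / 2 : ℕ)))) ≤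
      m * ((2 * B + 1) * 2 * 2 * (l : ℝ) ^ 12 * Real.exp (-(κ * √l))) := by
    have h0 : (l : ℝ) / 3 ≤ (l / 2 : ℕ) := by
      have : l ≤ 3 * (l / 2) := by omega
      have : (l : ℝ) ≤ 3 * (l / 2 : ℕ) := by exact_mod_cast this
      linarith
    have h1 : κ * √l ≤ c * (ε / 4) ^ 2 * (l / 2 : ℕ) := by
      calc κ * √l ≤ c / 96 * √l := by gcongr
        _ = c / 48 * (√l / 2) := by ring
        _ ≤ c / 48 * (ε ^ 2 * l) := by gcongr
        _ = c * (ε / 4) ^ 2 * (l / 3) := by ring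
        _ ≤ _ := by gcongr
    have h2 : (2 * r + 1 : ℝ) ≤ m * (2 * B + 1) * (l : ℝ) ^ 8 := by
      have : (1 : ℝ) ≤ m * (l : ℝ) ^ 8 := one_le_mul_of_one_le_of_one_le hm1 (one_le_pow₀ hl1)
      calc (2 * r + 1 : ℝ) ≤ 2 * ((6 * ν + 6) * m * (256 * (l : ℝ) ^ 8)) + m * (l : ℝ) ^ 8 := by
            gcongr
        _ = _ := by rw [hB]; ring
    calc (2 * r + 1) * (l + 1) * (2 * Real.exp (-(c * (ε / 4) ^ 2 * (l / 2 : ℕ))))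
        ≤ (m * (2 * B + 1) * (l : ℝ) ^ 8) * (l + l) * (2 * Real.exp (-(κ * √l))) := by gcongr
      _ = m * ((2 * B + 1) * 2 * 2 * (l : ℝ) ^ 9 * Real.exp (-(κ * √l))) := by ring
      _ ≤ _ := by
          gcongr
          norm_num
  have hH' : (H : ℝ) ≤ (6 * ν + 6) * m * (256 * (l : ℝ) ^ 8) := by
    calc (H : ℝ) ≤ r := by exact_mod_cast hHr
      _ ≤ _ := hr
  have c1 := E.measure_not_nearDensity_le hd hρ' hε hc.le hl2 H
  have c2 := E.measure_not_nearDensity_le hd hρ hε hc.le hl2 r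
  refine (add_le_add (add_le_add_right c1 _) c2).trans ?_
  unfold couplingError
  rw [← ENNReal.ofReal_add (by positivity) (by positivity),
    ← ENNReal.ofReal_add (by positivity) (by positivity),
    ← ENNReal.ofReal_add (by positivity) (by positivity)]
  refine ENNReal.ofReal_le_ofReal ?_
  have e1 := b3 H hH'
  have e2 := b3 r hr
  calc _ ≤ m * (K * (l : ℝ) ^ 12 * Real.exp (-(κ * √l))) := by
        rw [hK]; linarith
    _ ≤ _ := by gcongr

/-- Deviations of the walk after `m` blocks of large length `L`. -/
lemma exists_deviation_bound {ν : ℝ} (hν : 0 < ν) (hdrift : E.NoDriftIn ν)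
    (hcover : E.Covering ν) {pE pO : ℝ} (hp : pE ≤ pO) :
    ∃ L₀ : ℕ, 1 ≤ L₀ ∧ ∀ L ≥ L₀, ∀ ρ ∈ Set.Ioo a b, ∀ ε < 1, (L : ℝ) ^ (-(1 / 32) : ℝ) ≤ ε →
      ∀ s : ℤ, s = 1 ∨ s = -1 → ρ + s * ε ∈ Set.Ioo a b → ∀ m ≥ 1, ∀ y ≥ 0,
      (annealed (E.law ρ)).real
        {ω | m * (s * (L * E.finiteRangeSpeed pE pO (ρ + s * ε) L) + 2 * √L) + y ≤
          s * walkFrom pE pO 0 ω.1 ω.2 (m * L)} ≤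
        Real.exp (-(y ^ 2 / (2 * m * L ^ 2))) + m ^ 2 * Real.exp (-(L : ℝ) ^ (1 / 64 : ℝ)) := by
  obtain ⟨C, C', hC, hC', hcov⟩ := hcover
  obtain ⟨c, hc, hd⟩ := E.density
  have hνev : ∀ᶠ l : ℕ in atTop, 1 < ν ^ 8 * (l ^ 4 : ℕ) := by
    have : Tendsto (fun l : ℕ => ν ^ 8 * ((l ^ 4 : ℕ) : ℝ)) atTop atTop :=
      Tendsto.const_mul_atTop (by positivity)
        (tendsto_natCast_atTop_atTop.comp (tendsto_pow_atTop (by norm_num)))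
    exact this.eventually_gt_atTop 1
  obtain ⟨l₀, hl₀⟩ := eventually_atTop.mp ((eventually_error_le (E := E) hν hC' hc hd).and
    ((eventually_log_cube_lt hν C).and (hνev.and (eventually_ge_atTop 2))))
  refine ⟨(l₀ + 1) ^ 8, Nat.one_le_pow _ _ (by omega), ?_⟩
  intro L hL ρ hρ ε hε1 hεL s hs hρε m hm y hy
  have hL1 : 1 ≤ L := le_trans (Nat.one_le_pow _ _ (by omega)) hL
  have hL1' : (1 : ℝ) ≤ L := by exact_mod_cast hL1
  -- With this scale the covering time `l ^ 4` is at most `√L`, so the head start costs at most `2 *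
  -- √L` per block, while `L ≤ (2 l) ^ 8 = 256 l ^ 8` keeps all windows polynomial in `l`.
  set l : ℕ := ⌊(L : ℝ) ^ (1 / 8 : ℝ)⌋₊ with hl
  have hroot8 (x : ℝ) (hx : 0 ≤ x) : (x ^ 8) ^ (1 / 8 : ℝ) = x := by
    rw [← Real.rpow_natCast, ← Real.rpow_mul hx]; norm_num
  have hpow8 : ((L : ℝ) ^ (1 / 8 : ℝ)) ^ 8 = L := by
    rw [← Real.rpow_natCast, ← Real.rpow_mul (by positivity)]; norm_num
  have hll₀ : l₀ ≤ l := by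
    refine Nat.le_floor ?_
    have h1 : ((l₀ : ℝ) + 1) ^ 8 ≤ L := by exact_mod_cast hL
    calc (l₀ : ℝ) ≤ l₀ + 1 := by linarith
      _ = (((l₀ : ℝ) + 1) ^ 8) ^ (1 / 8 : ℝ) := (hroot8 _ (by positivity)).symm
      _ ≤ _ := by gcongr
  obtain ⟨herr, hlog, hνl, hl2⟩ := hl₀ l hll₀
  have hlL : (l : ℝ) ≤ (L : ℝ) ^ (1 / 8 : ℝ) := Nat.floor_le (by positivity)
  have hLl : (L : ℝ) ^ (1 / 8 : ℝ) ≤ 2 * l := by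
    have := Nat.lt_floor_add_one ((L : ℝ) ^ (1 / 8 : ℝ))
    have h2 : (2 : ℝ) ≤ l := by exact_mod_cast hl2
    rw [← hl] at this
    linarith
  have hl8 : l ^ 8 ≤ L := by
    have : (l : ℝ) ^ 8 ≤ L := by rw [← hpow8]; gcongr
    exact_mod_cast this
  have hL256 : (L : ℝ) ≤ 256 * (l : ℝ) ^ 8 := by
    rw [← hpow8]
    calc ((L : ℝ) ^ (1 / 8 : ℝ)) ^ 8 ≤ (2 * l) ^ 8 := by gcongr
      _ = _ := by ring
  have hl4 : l ^ 4 + l ≤ L := by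
    have h1 : 16 ≤ l ^ 4 := by
      calc 16 = 2 ^ 4 := by norm_num
        _ ≤ l ^ 4 := Nat.pow_le_pow_left hl2 4
    have h2 : l ≤ l ^ 4 := Nat.le_self_pow (by norm_num) l
    have h3 : l ^ 8 = l ^ 4 * l ^ 4 := by ring
    nlinarith
  have hl4s : ((l ^ 4 : ℕ) : ℝ) ≤ √L := by
    refine Real.le_sqrt_of_sq_le ?_
    have h1 : (l ^ 4) ^ 2 ≤ L := by rw [← pow_mul]; exact hl8
    exact_mod_cast h1
  set n := L - l ^ 4 with hn
  have hnL : l ^ 4 + n = L := by omega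
  have hnL' : ((l ^ 4 : ℕ) : ℝ) + n = L := by exact_mod_cast hnL
  have hln : l ≤ n := by omega
  have hε0 : 0 < ε := lt_of_lt_of_le (by positivity) hεL
  have hl0 : (0 : ℝ) < l := by exact_mod_cast (by omega : 0 < l)
  have hε2 : (2 * √(l : ℝ))⁻¹ ≤ ε ^ 2 := by
    have h1 : (L : ℝ) ^ (1 / 16 : ℝ) ≤ 2 * √l := by
      calc (L : ℝ) ^ (1 / 16 : ℝ) = √((L : ℝ) ^ (1 / 8 : ℝ)) := by
            rw [Real.sqrt_eq_rpow, ← Real.rpow_mul (by positivity)]; norm_num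
        _ ≤ √(2 * l) := Real.sqrt_le_sqrt hLl
        _ ≤ √(2 ^ 2 * l) := Real.sqrt_le_sqrt (by linarith)
        _ = 2 * √l := by rw [Real.sqrt_mul (by norm_num), Real.sqrt_sq (by norm_num)]
    calc (2 * √(l : ℝ))⁻¹ ≤ ((L : ℝ) ^ (1 / 16 : ℝ))⁻¹ := by gcongr
      _ = ((L : ℝ) ^ (-(1 / 32) : ℝ)) ^ 2 := by
          rw [← Real.rpow_neg (by positivity), ← Real.rpow_natCast,
            ← Real.rpow_mul (by positivity)]
          norm_num
      _ ≤ ε ^ 2 := by gcongr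
  -- The window must hold the `L` steps of a block plus the loss `2 ν n ≤ 2 ν L`; `H` adds the
  -- covering loss, at most `4 ν L`.
  set H' : ℕ := ⌈(2 * ν + 1) * L⌉₊ with hH'
  set H : ℕ := H' + ⌈4 * ν * L⌉₊ with hH
  have hH'1 : (2 * ν + 1) * L ≤ H' := Nat.le_ceil _
  have hH1 : (H' : ℝ) + 4 * ν * L ≤ H := by
    rw [hH]; push_cast; gcongr; exact Nat.le_ceil _
  have hH2 : (H : ℝ) ≤ (6 * ν + 3) * L := by
    have h1 : (H' : ℝ) < (2 * ν + 1) * L + 1 := Nat.ceil_lt_add_one (by positivity)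
    have h2 : (⌈4 * ν * L⌉₊ : ℝ) < 4 * ν * L + 1 := Nat.ceil_lt_add_one (by positivity)
    rw [hH]; push_cast
    linarith
  have hl4L : ((l ^ 4 : ℕ) : ℝ) ≤ L := by
    exact_mod_cast (by omega : l ^ 4 ≤ L)
  have hnL2 : (n : ℝ) ≤ L := by exact_mod_cast (by omega : n ≤ L)
  have hm1 : (1 : ℝ) ≤ m := by exact_mod_cast hm
  have hcond : C * (ε ^ 2)⁻¹ * (1 + |Real.log (ν * (l ^ 4 : ℕ)) ^ 3|) < ν * l := by
    refine lt_of_le_of_lt ?_ hlog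
    gcongr
    exact inv_le_of_inv_le₀ (by positivity) hε2
  have hblock : ∀ σ, NearDensity ρ ε l (H + 2 * l ^ 4) σ → ∀ u c, _ := fun σ hσ u c =>
    measure_block_le (C := C) (C' := C') hν hdrift hcov hp hρ ⟨hε0, hε1⟩ hs hρε hl2 (n := n)
      (H := H) (H' := H')
      (le_trans (by gcongr) hH1)
      (by
        have : 2 * ν * n ≤ 2 * ν * L := by gcongr
        linarith) hνl hcond hσ u c
  rw [hnL] at hblock
  set r : ℕ := H + 2 * l ^ 4 + m * L with hr
  have hL256' : (6 * ν + 6) * (L : ℝ) ≤ (6 * ν + 6) * (256 * (l : ℝ) ^ 8) := by gcongr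
  have hrb : (r : ℝ) ≤ (6 * ν + 6) * m * (256 * (l : ℝ) ^ 8) := by
    have h1 : (L : ℝ) ≤ m * L := le_mul_of_one_le_left (by positivity) hm1
    have hr' : (r : ℝ) = H + 2 * ((l ^ 4 : ℕ) : ℝ) + m * L := by rw [hr]; push_cast; ring
    calc (r : ℝ) ≤ (6 * ν + 3) * L + 2 * L + m * L := by rw [hr']; linarith
      _ = (6 * ν + 5) * L + m * L := by ring
      _ ≤ (6 * ν + 5) * (m * L) + m * L := by gcongr
      _ = (6 * ν + 6) * m * L := by ring
      _ ≤ _ := by gcongr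
  have herr' := herr (n := n) (H := H) (r := r) (m := m) hρ hρε ⟨hε0, hε1⟩ hε2 hln (by omega) hm
    hrb (by nlinarith)
  have h := E.annealed_deviation_le (d := 2 * (l ^ 4 : ℕ)) (r := r) (m := m)
    (x := m * Real.exp (-(2 * (l : ℝ) ^ (1 / 8 : ℝ)))) hρ hs hblock
    le_rfl (by positivity) herr' hm hL1 hy
  have hexp : (L : ℝ) ^ (1 / 64 : ℝ) ≤ 2 * (l : ℝ) ^ (1 / 8 : ℝ) := by
    calc (L : ℝ) ^ (1 / 64 : ℝ) = ((L : ℝ) ^ (1 / 8 : ℝ)) ^ (1 / 8 : ℝ) := by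
          rw [← Real.rpow_mul (by positivity)]; norm_num
      _ ≤ (2 * l) ^ (1 / 8 : ℝ) := by gcongr
      _ = 2 ^ (1 / 8 : ℝ) * (l : ℝ) ^ (1 / 8 : ℝ) := Real.mul_rpow (by norm_num) hl0.le
      _ ≤ 2 ^ (1 : ℝ) * (l : ℝ) ^ (1 / 8 : ℝ) := by
          gcongr
          · norm_num
          · norm_num
      _ = _ := by rw [Real.rpow_one]
  calc _ ≤ (annealed (E.law ρ)).real {ω | m * (s * (L * E.finiteRangeSpeed pE pO (ρ + s * ε) L) +
        ((2 * (l ^ 4 : ℕ) : ℤ) : ℝ)) + y ≤ s * walkFrom pE pO 0 ω.1 ω.2 (m * L)} := by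
        refine measureReal_mono (fun ω hω => ?_)
        simp only [Set.mem_ofPred_eq] at hω ⊢
        refine le_trans ?_ hω
        gcongr
        push_cast at hl4s ⊢
        linarith
    _ ≤ _ := h
    _ = Real.exp (-(y ^ 2 / (2 * m * L ^ 2))) +
        m ^ 2 * Real.exp (-(2 * (l : ℝ) ^ (1 / 8 : ℝ))) := by ring
    _ ≤ _ := by gcongr

end Environment

/-- The budget for comparing speeds at two scales: rounding to whole blocks, head starts, the
allowed fluctuation, and twice the probability of a larger one. In terms of `z = L ^ (1/64)`, with
right side `z⁻²`, every term but the third carries a factor that decays faster than `z⁻²`. -/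
lemma eventually_scale_sum_le : ∀ᶠ L : ℕ in atTop,
    2 / (L : ℝ) + 2 * √L / L + (L : ℝ) ^ (-(1 / 32) : ℝ) / 4 +
      2 * (Real.exp (-(L * ((L : ℝ) ^ (-(1 / 32) : ℝ)) ^ 2 / 32)) +
        (L : ℝ) ^ 6 * Real.exp (-(L : ℝ) ^ (1 / 64 : ℝ))) ≤ (L : ℝ) ^ (-(1 / 32) : ℝ) := by
  have hz : Tendsto (fun l : ℕ => (l : ℝ) ^ (1 / 64 : ℝ)) atTop atTop :=
    (tendsto_rpow_atTop (by norm_num)).comp tendsto_natCast_atTop_atTop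
  have h1 := (Real.tendsto_pow_mul_exp_neg_atTop_nhds_zero 2).eventually_le_const
    (show (0 : ℝ) < 1 / 16 by norm_num)
  have h2 := (Real.tendsto_pow_mul_exp_neg_atTop_nhds_zero 386).eventually_le_const
    (show (0 : ℝ) < 1 / 16 by norm_num)
  filter_upwards [hz.eventually (h1.and (h2.and (eventually_ge_atTop 32)))] with L hL
  obtain ⟨k1, k2, k3⟩ := hL
  set z : ℝ := (L : ℝ) ^ (1 / 64 : ℝ) with hzdef
  have hz0 : 0 < z := by linarith
  have hL0 : (0 : ℝ) ≤ L := by positivity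
  have e1 : (L : ℝ) = z ^ 64 := by
    rw [hzdef, ← Real.rpow_natCast, ← Real.rpow_mul hL0]; norm_num
  have e2 : (L : ℝ) ^ (-(1 / 32) : ℝ) = (z ^ 2)⁻¹ := by
    rw [hzdef, ← Real.rpow_natCast, ← Real.rpow_mul hL0, ← Real.rpow_neg hL0]; norm_num
  have e3 : √(L : ℝ) = z ^ 32 := by
    rw [e1, show z ^ 64 = (z ^ 32) ^ 2 by ring, Real.sqrt_sq (by positivity)]
  rw [e2, e3, e1]
  have hzz (k : ℕ) (hk : k ≠ 0) : 32 ≤ z ^ k := k3.trans (le_self_pow₀ (by linarith) hk)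
  have b1 : 2 / z ^ 64 ≤ (z ^ 2)⁻¹ * (1 / 16) := by
    rw [show z ^ 64 = z ^ 2 * z ^ 62 by ring, div_le_iff₀ (by positivity)]
    have := hzz 62 (by norm_num)
    field_simp
    linarith
  have b2 : 2 * z ^ 32 / z ^ 64 ≤ (z ^ 2)⁻¹ * (1 / 16) := by
    rw [show z ^ 64 = z ^ 32 * (z ^ 2 * z ^ 30) by ring, div_le_iff₀ (by positivity)]
    have := hzz 30 (by norm_num)
    have h3 : 0 < z ^ 32 := by positivity
    field_simp
    linarith
  have b3 : Real.exp (-(z ^ 64 * ((z ^ 2)⁻¹) ^ 2 / 32)) ≤ (z ^ 2)⁻¹ * (1 / 16) := by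
    have h3 : z ^ 64 * ((z ^ 2)⁻¹) ^ 2 = z * z ^ 59 := by field_simp
    have h4 := hzz 59 (by norm_num)
    have h5 : z ≤ z ^ 64 * ((z ^ 2)⁻¹) ^ 2 / 32 := by rw [h3]; nlinarith
    calc Real.exp (-(z ^ 64 * ((z ^ 2)⁻¹) ^ 2 / 32)) ≤ Real.exp (-z) := by gcongr
      _ = (z ^ 2)⁻¹ * (z ^ 2 * Real.exp (-z)) := by field_simp
      _ ≤ _ := by gcongr
  have b4 : (z ^ 64) ^ 6 * Real.exp (-z) ≤ (z ^ 2)⁻¹ * (1 / 16) := by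
    calc (z ^ 64) ^ 6 * Real.exp (-z) = (z ^ 2)⁻¹ * (z ^ 386 * Real.exp (-z)) := by
          field_simp
      _ ≤ _ := by gcongr
  have : 0 < (z ^ 2)⁻¹ := by positivity
  linarith

/-! ### One-sided limits of monotone functions along a set. -/

lemma exists_tendsto_of_monotoneOn_Ioi {f : ℝ → ℝ} {s : Set ℝ} {x : ℝ} (hf : MonotoneOn f s)
    (hb : BddBelow (f '' (s ∩ Set.Ioi x))) (hne : (𝓝[s ∩ Set.Ioi x] x).NeBot) :
    ∃ l, Tendsto f (𝓝[s ∩ Set.Ioi x] x) (𝓝 l) := by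
  have hne' : (s ∩ Set.Ioi x).Nonempty :=
    closure_nonempty_iff.mp ⟨x, mem_closure_iff_nhdsWithin_neBot.mpr hne⟩
  refine ⟨sInf (f '' (s ∩ Set.Ioi x)), tendsto_order.mpr ⟨fun c hc => ?_, fun c hc => ?_⟩⟩
  · filter_upwards [self_mem_nhdsWithin] with y hy
    exact hc.trans_le (csInf_le hb (Set.mem_image_of_mem f hy))
  · obtain ⟨_, ⟨y, hy, rfl⟩, hyc⟩ := exists_lt_of_csInf_lt (hne'.image f) hc
    filter_upwards [self_mem_nhdsWithin, mem_nhdsWithin_of_mem_nhds (Iio_mem_nhds hy.2)]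
      with w hw hwy
    exact (hf hw.1 hy.1 (le_of_lt hwy)).trans_lt hyc

lemma exists_tendsto_of_monotoneOn_Iio {f : ℝ → ℝ} {s : Set ℝ} {x : ℝ} (hf : MonotoneOn f s)
    (hb : BddAbove (f '' (s ∩ Set.Iio x))) (hne : (𝓝[s ∩ Set.Iio x] x).NeBot) :
    ∃ l, Tendsto f (𝓝[s ∩ Set.Iio x] x) (𝓝 l) := by
  have hne' : (s ∩ Set.Iio x).Nonempty :=
    closure_nonempty_iff.mp ⟨x, mem_closure_iff_nhdsWithin_neBot.mpr hne⟩
  refine ⟨sSup (f '' (s ∩ Set.Iio x)), tendsto_order.mpr ⟨fun c hc => ?_, fun c hc => ?_⟩⟩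
  · obtain ⟨_, ⟨y, hy, rfl⟩, hyc⟩ := exists_lt_of_lt_csSup (hne'.image f) hc
    filter_upwards [self_mem_nhdsWithin, mem_nhdsWithin_of_mem_nhds (Ioi_mem_nhds hy.2)]
      with w hw hwy
    exact hyc.trans_le (hf hy.1 hw.1 (le_of_lt hwy))
  · filter_upwards [self_mem_nhdsWithin] with y hy
    exact (le_csSup hb (Set.mem_image_of_mem f hy)).trans_lt hc

/-! ### Speeds at different densities and scales. -/

namespace Environment

variable {a b : ℝ} {E : Environment a b}

/-- Couple the initial configurations, then the evolutions, and use the same uniforms: the walks are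
ordered. Adding `L` makes the integrand nonnegative. The second coupling is chosen separately for
each pair of configurations and only yields an inequality between integrals, so no measurable
selection is needed. -/
lemma finiteRangeSpeed_mono {pE pO : ℝ} (hp : pE ≤ pO) (L : ℕ) :
    MonotoneOn (fun ρ => E.finiteRangeSpeed pE pO ρ L) (Set.Ioo a b) := by
  intro ρ' hρ' ρ hρ hle
  simp only
  rcases Nat.eq_zero_or_pos L with rfl | hL
  · simp [finiteRangeSpeed]
  have hL' : (0 : ℝ) < L := by exact_mod_cast hL
  refine le_of_mul_le_mul_left ?_ hL'
  rw [← E.integral_walkFrom_eq, ← E.integral_walkFrom_eq]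
  set f : EnvPath × (ℕ → unitInterval) → ℝ := fun ω => walkFrom pE pO 0 ω.1 ω.2 L + L with hf
  have hfm : Measurable f := (measurable_walkFrom_real pE pO L).add_const _
  have hf0 (ω) : 0 ≤ f ω := by
    have := (abs_le.mp (abs_walkFrom_le pE pO ω.1 ω.2 L)).1
    simp only [hf]; linarith
  have hint (r : ℝ) : ∫ ω, f ω ∂(annealed (E.law r)) =
      ∫ ω, (walkFrom pE pO 0 ω.1 ω.2 L : ℝ) ∂(annealed (E.law r)) + L := by
    simp only [hf]
    rw [integral_add (integrable_walkFrom _ pE pO L) (integrable_const _)]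
    simp
  suffices h : ∫⁻ ω, ENNReal.ofReal (f ω) ∂(annealed (E.law ρ')) ≤
      ∫⁻ ω, ENNReal.ofReal (f ω) ∂(annealed (E.law ρ)) by
    have h2 : ∫ ω, f ω ∂(annealed (E.law ρ')) ≤ ∫ ω, f ω ∂(annealed (E.law ρ)) := by
      rw [integral_eq_lintegral_of_nonneg_ae (ae_of_all _ hf0) hfm.aestronglyMeasurable,
        integral_eq_lintegral_of_nonneg_ae (ae_of_all _ hf0) hfm.aestronglyMeasurable]
      refine ENNReal.toReal_mono ?_ h
      have hi : Integrable f (annealed (E.law ρ)) :=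
        (integrable_walkFrom _ pE pO L).add (integrable_const _)
      rw [← ofReal_integral_eq_lintegral_ofReal hi (ae_of_all _ hf0)]
      exact ENNReal.ofReal_ne_top
    rw [hint, hint] at h2
    linarith
  rw [lintegral_annealed _ hfm.ennreal_ofReal, lintegral_annealed _ hfm.ennreal_ofReal]
  refine lintegral_mono (fun u => ?_)
  have hgm : Measurable (fun η : EnvPath => ENNReal.ofReal (f (η, u))) :=
    (hfm.comp (measurable_id.prodMk measurable_const)).ennreal_ofReal
  have hkm : Measurable (fun σ : Config => ∫⁻ η, ENNReal.ofReal (f (η, u)) ∂(E.P σ)) :=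
    hgm.lintegral_kernel
  obtain ⟨Q, hQ, hQle⟩ := E.monotone_density ρ hρ ρ' hρ' hle
  simp only
  rw [E.lintegral_law ρ' hgm, E.lintegral_law ρ hgm, hQ.lintegral_fst hkm, hQ.lintegral_snd hkm]
  refine lintegral_mono_ae ?_
  filter_upwards [hQle] with ω hω
  obtain ⟨R, hR, hRle⟩ := E.monotone_quenched ω.1 ω.2 hω
  rw [hR.lintegral_fst hgm, hR.lintegral_snd hgm]
  refine lintegral_mono_ae ?_
  filter_upwards [hRle] with ξ hξ
  refine ENNReal.ofReal_le_ofReal ?_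
  have := walkFrom_mono hp (x := 0) (x' := 0) le_rfl (by simp) (η := ξ.2) (η' := ξ.1) u (n := L)
    (r := L) (by simp) (fun s _ x _ => hξ s x)
  simp only [hf]
  gcongr

/-- Apply the deviation bound to `m = n / L` blocks and take expectations, using `|X_n| ≤ n` on the
bad event. The lower bound on `n` gives `m ≥ L`, making the Gaussian term small and the incomplete
block negligible; the upper bound gives `m ^ 2 ≤ L ^ 6`, harmless against the stretched exponential.
-/
lemma exists_finiteRangeSpeed_le_of_pow {ν : ℝ} (hν : 0 < ν) (hdrift : E.NoDriftIn ν)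
    (hcover : E.Covering ν) {pE pO : ℝ} (hp : pE ≤ pO) :
    ∃ L₀ : ℕ, 2 ≤ L₀ ∧ ∀ L ≥ L₀, (L : ℝ) ^ (-(1 / 32) : ℝ) ≤ 1 / 2 ∧
      ∀ ρ ∈ Set.Ioo a b, ρ + (L : ℝ) ^ (-(1 / 32) : ℝ) ∈ Set.Ioo a b →
      ∀ n, L ^ 2 ≤ n → n ≤ L ^ 4 → E.finiteRangeSpeed pE pO ρ n ≤
        E.finiteRangeSpeed pE pO (ρ + (L : ℝ) ^ (-(1 / 32) : ℝ)) L +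
          (L : ℝ) ^ (-(1 / 32) : ℝ) := by
  obtain ⟨L₁, -, hdev⟩ := exists_deviation_bound hν hdrift hcover hp
  have hg : Tendsto (fun L : ℕ => (L : ℝ) ^ (-(1 / 32) : ℝ)) atTop (𝓝 0) :=
    (tendsto_rpow_neg_atTop (by norm_num)).comp tendsto_natCast_atTop_atTop
  obtain ⟨L₂, hL₂⟩ := eventually_atTop.mp
    (eventually_scale_sum_le.and (hg.eventually_le_const (show (0 : ℝ) < 1 / 2 by norm_num)))
  refine ⟨max 2 (max L₁ L₂), le_max_left _ _, fun L hL => ?_⟩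
  have hLL₁ : L ≥ L₁ := le_trans (le_trans (le_max_left _ _) (le_max_right _ _)) hL
  have hLL₂ : L ≥ L₂ := le_trans (le_trans (le_max_right _ _) (le_max_right _ _)) hL
  have hL1 : 1 ≤ L := le_trans (by norm_num) (le_trans (le_max_left _ _) hL)
  obtain ⟨hsum, hhalf⟩ := hL₂ L hLL₂
  refine ⟨hhalf, fun ρ hρ hρg n hn1 hn2 => ?_⟩
  set g : ℝ := (L : ℝ) ^ (-(1 / 32) : ℝ) with hgdef
  have hL0 : (0 : ℝ) < L := by exact_mod_cast hL1
  have hg0 : 0 < g := by positivity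
  have hn0 : 0 < n := lt_of_lt_of_le (by positivity) hn1
  have hn0' : (0 : ℝ) < n := by exact_mod_cast hn0
  set m := n / L with hm
  have hmL : L ≤ m := by rw [hm, Nat.le_div_iff_mul_le hL1]; nlinarith
  have hm3 : m ≤ L ^ 3 := by
    rw [hm]; exact Nat.div_le_of_le_mul (hn2.trans (by rw [pow_succ' L 3]))
  have hmn : m * L ≤ n := Nat.div_mul_le_self n L
  have hnm : n < m * L + L := by
    have := Nat.lt_div_mul_add (a := n) hL1
    rwa [← hm] at this
  have hmL' : (L : ℝ) ≤ m := by exact_mod_cast hmL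
  have hm0 : (0 : ℝ) < m := hL0.trans_le hmL'
  have hm3' : (m : ℝ) ≤ (L : ℝ) ^ 3 := by exact_mod_cast hm3
  have hmn' : (m : ℝ) * L ≤ n := by exact_mod_cast hmn
  have hnm' : (n : ℝ) ≤ m * L + L := by exact_mod_cast hnm.le
  have hnL' : (L : ℝ) * L ≤ n := by
    have : L * L ≤ n := by nlinarith
    exact_mod_cast this
  set v := E.finiteRangeSpeed pE pO (ρ + g) L with hv
  have hv1 := abs_le.mp (E.abs_finiteRangeSpeed_le pE pO (ρ + g) L)
  rw [← hv] at hv1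
  set y : ℝ := m * L * g / 4 with hy
  set A : ℝ := m * (L * v + 2 * √L) + y with hA
  have h := hdev L hLL₁ ρ hρ g (by linarith) le_rfl 1 (Or.inl rfl) (by simpa using hρg) m
    (by omega) y (by positivity)
  simp only [Int.cast_one, one_mul] at h
  rw [← hv, ← hA] at h
  set B : Set (EnvPath × (ℕ → unitInterval)) := {ω | A ≤ walkFrom pE pO 0 ω.1 ω.2 (m * L)} with hB
  have hBm : MeasurableSet B := measurableSet_annealed_walk pE pO (m * L) (fun z => A ≤ z)
  have hpt (ω : EnvPath × (ℕ → unitInterval)) : (walkFrom pE pO 0 ω.1 ω.2 n : ℝ) ≤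
      (A + L) + B.indicator (fun _ => 2 * (n : ℝ)) ω := by
    by_cases hω : ω ∈ B
    · rw [Set.indicator_of_mem hω]
      have h1 := (abs_le.mp (abs_walkFrom_le pE pO ω.1 ω.2 n)).2
      have h2 : -(n : ℝ) ≤ A := by
        have h3 : m * L * (-1) ≤ m * L * v := by gcongr; exact hv1.1
        have h4 : 0 ≤ m * (2 * √(L : ℝ)) := by positivity
        have h5 : 0 ≤ y := by positivity
        rw [hA]; nlinarith
      linarith
    · rw [Set.indicator_of_notMem hω]
      have h1 : (walkFrom pE pO 0 ω.1 ω.2 (m * L) : ℝ) < A := by simpa [hB] using hω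
      have h2 : walkFrom pE pO 0 ω.1 ω.2 n ≤ walkFrom pE pO 0 ω.1 ω.2 (m * L) + (n - m * L : ℕ) := by
        have h3 := walkFrom_add pE pO 0 ω.1 ω.2 (n - m * L) (m * L)
        rw [Nat.add_sub_cancel' hmn] at h3
        rw [h3]
        have := (abs_le.mp (abs_walkFrom_sub_le pE pO (walkFrom pE pO 0 ω.1 ω.2 (m * L))
          (EnvPath.shift (m * L) 0 ω.1) (fun k => ω.2 (m * L + k)) (n - m * L))).2
        linarith
      have h4 : (walkFrom pE pO 0 ω.1 ω.2 n : ℝ) ≤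
          walkFrom pE pO 0 ω.1 ω.2 (m * L) + (n - m * L : ℕ) := by exact_mod_cast h2
      have h5 : ((n - m * L : ℕ) : ℝ) ≤ L := by exact_mod_cast (by omega : n - m * L ≤ L)
      linarith
  have hE : n * E.finiteRangeSpeed pE pO ρ n ≤
      (A + L) + 2 * n * (annealed (E.law ρ)).real B := by
    rw [← E.integral_walkFrom_eq]
    have hi : Integrable (B.indicator (fun _ => 2 * (n : ℝ))) (annealed (E.law ρ)) :=
      (integrable_const _).indicator hBm
    refine (integral_mono (integrable_walkFrom _ pE pO n) ((integrable_const _).add hi) hpt).trans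
      (le_of_eq ?_)
    rw [integral_add' (integrable_const _) hi, integral_indicator_const _ hBm]
    simp [mul_comm]
  have hp1 : (annealed (E.law ρ)).real B ≤ Real.exp (-(L * g ^ 2 / 32)) +
      (L : ℝ) ^ 6 * Real.exp (-(L : ℝ) ^ (1 / 64 : ℝ)) := by
    refine h.trans (add_le_add ?_ ?_)
    · have : y ^ 2 / (2 * m * L ^ 2) = m * g ^ 2 / 32 := by rw [hy]; field_simp; norm_num
      rw [this]; gcongr
    · have : (m : ℝ) ^ 2 ≤ (L : ℝ) ^ 6 := by
        calc (m : ℝ) ^ 2 ≤ ((L : ℝ) ^ 3) ^ 2 := by gcongr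
          _ = _ := by ring
      gcongr
  set p := Real.exp (-(L * g ^ 2 / 32)) + (L : ℝ) ^ 6 * Real.exp (-(L : ℝ) ^ (1 / 64 : ℝ)) with hpdef
  have hfin : n * E.finiteRangeSpeed pE pO ρ n ≤ n * (v + g) := by
    have c1 : m * L * v ≤ n * v + L := by nlinarith
    have c2 : 2 * (L : ℝ) ≤ n * (2 / L) := by
      rw [mul_div_assoc', le_div_iff₀ hL0]; linarith
    have c3 : m * (2 * √(L : ℝ)) ≤ n * (2 * √L / L) := by
      rw [mul_div_assoc', le_div_iff₀ hL0]
      calc m * (2 * √(L : ℝ)) * L = (m * L) * (2 * √(L : ℝ)) := by ring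
        _ ≤ n * (2 * √(L : ℝ)) := by gcongr
    have c4 : y ≤ n * (g / 4) := by
      calc y = m * L * (g / 4) := by rw [hy]; ring
        _ ≤ _ := by gcongr
    have c5 : 2 * n * (annealed (E.law ρ)).real B ≤ n * (2 * p) := by
      calc 2 * n * (annealed (E.law ρ)).real B ≤ 2 * n * p := by gcongr
        _ = _ := by ring
    have c6 := mul_le_mul_of_nonneg_left hsum hn0'.le
    rw [hA] at hE
    nlinarith
  exact le_of_mul_le_mul_left hfin hn0'

/-- The speed at large scales is controlled by the speed at scale `L` and a slightly larger
density. -/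
lemma exists_finiteRangeSpeed_le {ν : ℝ} (hν : 0 < ν) (hdrift : E.NoDriftIn ν)
    (hcover : E.Covering ν) {pE pO : ℝ} (hp : pE ≤ pO) :
    ∃ L₀ : ℕ, ∀ n L, L₀ ≤ L → L ^ 2 ≤ n → ∀ ρ ∈ Set.Ioo a b,
      ρ + 2 * (L : ℝ) ^ (-(1 / 32) : ℝ) ∈ Set.Ioo a b → E.finiteRangeSpeed pE pO ρ n ≤
        E.finiteRangeSpeed pE pO (ρ + 2 * (L : ℝ) ^ (-(1 / 32) : ℝ)) L +
          2 * (L : ℝ) ^ (-(1 / 32) : ℝ) := by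
  obtain ⟨L₀, hL₀2, hL₀⟩ := exists_finiteRangeSpeed_le_of_pow hν hdrift hcover hp
  refine ⟨L₀, fun n L => ?_⟩
  induction hk : n - L using Nat.strong_induction_on generalizing L with
  | _ k ih =>
    intro hL hn ρ hρ hρg
    obtain ⟨hhalf, hstep⟩ := hL₀ L hL
    have hL2 : 2 ≤ L := hL₀2.trans hL
    set g : ℝ := (L : ℝ) ^ (-(1 / 32) : ℝ) with hg
    have hg0 : 0 < g := by positivity
    have hmono (L : ℕ) := finiteRangeSpeed_mono (E := E) hp L
    have hin (x : ℝ) (h0 : 0 ≤ x) (h1 : x ≤ 2 * g) : ρ + x ∈ Set.Ioo a b :=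
      ⟨by linarith [hρ.1], by linarith [hρg.2]⟩
    by_cases hn4 : n ≤ L ^ 4
    · have h1 := hstep ρ hρ (hin g hg0.le (by linarith)) n hn hn4
      have h2 := hmono L (hin g hg0.le (by linarith)) hρg (by linarith)
      simp only at h2
      linarith
    -- Pass from `n` to `L ^ 2` by induction, then from `L ^ 2` to `L` by one direct step. With `g =
    -- L ^ (-1/32)` the gap at scale `L ^ 2` is `g ^ 2`, and `g ≤ 1 / 2` gives `2 g ^ 2 + g ≤ 2 g`,
    -- so the total cost does not grow.
    · have hLsq : L < L ^ 2 := by nlinarith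
      have hLn : L ^ 2 ≤ n := hn
      have hgsq : ((L ^ 2 : ℕ) : ℝ) ^ (-(1 / 32) : ℝ) = g ^ 2 := by
        push_cast
        rw [hg, ← Real.rpow_natCast, ← Real.rpow_natCast, ← Real.rpow_mul (by positivity),
          ← Real.rpow_mul (by positivity), mul_comm]
      have hgg : 2 * g ^ 2 ≤ g := by nlinarith
      have h1 := ih (n - L ^ 2) (by omega) (L ^ 2) rfl (by omega)
        (by rw [← pow_mul]; exact (not_le.mp hn4).le) ρ hρ
      rw [hgsq] at h1
      have h1 := h1 (hin _ (by positivity) (by linarith))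
      have h2 := hmono (L ^ 2) (hin (2 * g ^ 2) (by positivity) (by linarith))
        (hin g hg0.le (by linarith)) (by linarith)
      simp only at h2
      have h3 := hstep (ρ + g) (hin g hg0.le (by linarith))
        (by rw [add_assoc, ← two_mul]; exact hρg) (L ^ 2) le_rfl
        (Nat.pow_le_pow_right (by omega) (by norm_num))
      rw [add_assoc ρ g g, ← two_mul] at h3
      linarith

/-! ### Existence of the speed on a dense set and its one-sided limits. -/

section Limits

variable (pE pO : ℝ) (ρ : ℝ)

lemma isBoundedUnder_le_finiteRangeSpeed :
    IsBoundedUnder (· ≤ ·) atTop (E.finiteRangeSpeed pE pO ρ) :=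
  isBoundedUnder_of ⟨1, fun L => (abs_le.mp (E.abs_finiteRangeSpeed_le pE pO ρ L)).2⟩

lemma isBoundedUnder_ge_finiteRangeSpeed :
    IsBoundedUnder (· ≥ ·) atTop (E.finiteRangeSpeed pE pO ρ) :=
  isBoundedUnder_of ⟨-1, fun L => (abs_le.mp (E.abs_finiteRangeSpeed_le pE pO ρ L)).1⟩

lemma tendsto_finiteRangeSpeed {ρ : ℝ} (hρ : ρ ∈ E.speedDomain pE pO) :
    Tendsto (E.finiteRangeSpeed pE pO ρ) atTop (𝓝 (E.speed pE pO ρ)) :=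
  tendsto_nhds_limUnder hρ.2

lemma abs_speed_le {ρ : ℝ} (hρ : ρ ∈ E.speedDomain pE pO) : |E.speed pE pO ρ| ≤ 1 :=
  le_of_tendsto (tendsto_finiteRangeSpeed pE pO hρ).abs
    (Eventually.of_forall fun L => E.abs_finiteRangeSpeed_le pE pO ρ L)

lemma speed_mono {pE pO : ℝ} (hp : pE ≤ pO) :
    MonotoneOn (E.speed pE pO) (E.speedDomain pE pO) := fun _ hx _ hy hxy =>
  le_of_tendsto_of_tendsto' (tendsto_finiteRangeSpeed pE pO hx) (tendsto_finiteRangeSpeed pE pO hy)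
    (fun L => finiteRangeSpeed_mono hp L hx.1 hy.1 hxy)

end Limits

/-- In the comparison of scales let `n → ∞` first with `L` fixed, then `L → ∞`; once `2 L ^ (-1/32)
≤ ρ' - ρ`, monotonicity replaces the shifted density by `ρ'`. -/
lemma limsup_finiteRangeSpeed_le_liminf {ν : ℝ} (hν : 0 < ν) (hdrift : E.NoDriftIn ν)
    (hcover : E.Covering ν) {pE pO : ℝ} (hp : pE ≤ pO) {ρ ρ' : ℝ} (hρ : ρ ∈ Set.Ioo a b)
    (hρ' : ρ' ∈ Set.Ioo a b) (h : ρ < ρ') :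
    limsup (E.finiteRangeSpeed pE pO ρ) atTop ≤ liminf (E.finiteRangeSpeed pE pO ρ') atTop := by
  obtain ⟨L₀, hL₀⟩ := exists_finiteRangeSpeed_le hν hdrift hcover hp
  have hg : Tendsto (fun L : ℕ => 2 * (L : ℝ) ^ (-(1 / 32) : ℝ)) atTop (𝓝 0) := by
    have := ((tendsto_rpow_neg_atTop (show (0 : ℝ) < 1 / 32 by norm_num)).comp
      tendsto_natCast_atTop_atTop).const_mul 2
    rwa [mul_zero] at this
  refine le_of_forall_pos_le_add (fun x hx => ?_)
  rw [← sub_le_iff_le_add]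
  refine le_liminf_of_le (isBoundedUnder_le_finiteRangeSpeed pE pO ρ').isCoboundedUnder_ge ?_
  filter_upwards [eventually_ge_atTop L₀, hg.eventually_le_const (sub_pos.mpr h),
    hg.eventually_le_const hx] with L h1 h2 h3
  have hmem : ρ + 2 * (L : ℝ) ^ (-(1 / 32) : ℝ) ∈ Set.Ioo a b := by
    have : 0 ≤ 2 * (L : ℝ) ^ (-(1 / 32) : ℝ) := by positivity
    exact ⟨by linarith [hρ.1], by linarith [hρ'.2]⟩
  have h4 := finiteRangeSpeed_mono (E := E) hp L hmem hρ' (by linarith)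
  simp only at h4
  have h5 : limsup (E.finiteRangeSpeed pE pO ρ) atTop ≤
      E.finiteRangeSpeed pE pO (ρ + 2 * (L : ℝ) ^ (-(1 / 32) : ℝ)) L +
        2 * (L : ℝ) ^ (-(1 / 32) : ℝ) := by
    refine limsup_le_of_le (isBoundedUnder_ge_finiteRangeSpeed pE pO ρ).isCoboundedUnder_le ?_
    filter_upwards [eventually_ge_atTop (L ^ 2)] with n hn
    exact hL₀ n L h1 hn ρ hρ hmem
  linarith

/-- The limsup `V` is monotone on `(a, b)`, hence continuous there off a countable set, whose
complement is dense. At a continuity point `ρ`, the liminf dominates `V r` for all `r < ρ`, so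
letting `r ↑ ρ` it dominates `V ρ`. -/
lemma exists_mem_speedDomain {ν : ℝ} (hν : 0 < ν) (hdrift : E.NoDriftIn ν)
    (hcover : E.Covering ν) {pE pO : ℝ} (hp : pE ≤ pO) {x y : ℝ} (hx : a ≤ x) (hy : y ≤ b)
    (hxy : x < y) : ∃ ρ ∈ E.speedDomain pE pO, x < ρ ∧ ρ < y := by
  set V : ℝ → ℝ := fun ρ => limsup (E.finiteRangeSpeed pE pO ρ) atTop with hV
  have hle (ρ : ℝ) : liminf (E.finiteRangeSpeed pE pO ρ) atTop ≤ V ρ :=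
    liminf_le_limsup (isBoundedUnder_le_finiteRangeSpeed pE pO ρ)
      (isBoundedUnder_ge_finiteRangeSpeed pE pO ρ)
  have hVm : MonotoneOn V (Set.Ioo a b) := by
    intro r hr r' hr' hrr
    rcases hrr.lt_or_eq with h | rfl
    · exact (limsup_finiteRangeSpeed_le_liminf hν hdrift hcover hp hr hr' h).trans (hle r')
    · exact le_rfl
  obtain ⟨ρ, hρ, hρ1, hρ2⟩ :=
    (hVm.countable_not_continuousWithinAt.dense_compl ℝ).exists_between hxy
  have hρJ : ρ ∈ Set.Ioo a b := ⟨by linarith, by linarith⟩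
  have hcont : ContinuousWithinAt V (Set.Ioo a b) ρ := by
    by_contra hc
    exact hρ ⟨hρJ, hc⟩
  refine ⟨ρ, ⟨hρJ, V ρ, ?_⟩, hρ1, hρ2⟩
  refine tendsto_of_le_liminf_of_limsup_le ?_ le_rfl
    (isBoundedUnder_le_finiteRangeSpeed pE pO ρ) (isBoundedUnder_ge_finiteRangeSpeed pE pO ρ)
  have hne : (𝓝[Set.Ioo a ρ] ρ).NeBot := right_nhdsWithin_Ioo_neBot hρJ.1
  have hlim : Tendsto V (𝓝[Set.Ioo a ρ] ρ) (𝓝 (V ρ)) :=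
    hcont.tendsto.mono_left (nhdsWithin_mono _ (Set.Ioo_subset_Ioo_right hρJ.2.le))
  refine le_of_tendsto hlim ?_
  filter_upwards [self_mem_nhdsWithin] with r hr
  exact limsup_finiteRangeSpeed_le_liminf hν hdrift hcover hp ⟨hr.1, hr.2.trans hρJ.2⟩ hρJ hr.2

lemma neBot_speedDomain {ν : ℝ} (hν : 0 < ν) (hdrift : E.NoDriftIn ν)
    (hcover : E.Covering ν) {pE pO : ℝ} (hp : pE ≤ pO) {ρ : ℝ} (hρ : ρ ∈ Set.Ioo a b) :
    (𝓝[E.speedDomain pE pO ∩ Set.Ioi ρ] ρ).NeBot ∧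
      (𝓝[E.speedDomain pE pO ∩ Set.Iio ρ] ρ).NeBot := by
  constructor
  · refine mem_closure_iff_nhdsWithin_neBot.mp (Metric.mem_closure_iff.mpr fun x hx => ?_)
    obtain ⟨r, hr, h1, h2⟩ := exists_mem_speedDomain hν hdrift hcover hp (x := ρ)
      (y := min b (ρ + x)) hρ.1.le (min_le_left _ _) (lt_min hρ.2 (by linarith))
    refine ⟨r, ⟨hr, h1⟩, ?_⟩
    rw [Real.dist_eq, abs_lt]
    constructor <;> linarith [min_le_right b (ρ + x)]
  · refine mem_closure_iff_nhdsWithin_neBot.mp (Metric.mem_closure_iff.mpr fun x hx => ?_)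
    obtain ⟨r, hr, h1, h2⟩ := exists_mem_speedDomain hν hdrift hcover hp (x := max a (ρ - x))
      (y := ρ) (le_max_left _ _) hρ.2.le (max_lt hρ.1 (by linarith))
    refine ⟨r, ⟨hr, h2⟩, ?_⟩
    rw [Real.dist_eq, abs_lt]
    constructor <;> linarith [le_max_right a (ρ - x)]

lemma tendsto_speedPlus {pE pO : ℝ} (hp : pE ≤ pO) {ρ : ℝ}
    (h : (𝓝[E.speedDomain pE pO ∩ Set.Ioi ρ] ρ).NeBot) :
    Tendsto (E.speed pE pO) (𝓝[E.speedDomain pE pO ∩ Set.Ioi ρ] ρ)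
      (𝓝 (E.speedPlus pE pO ρ)) := by
  refine tendsto_nhds_limUnder (exists_tendsto_of_monotoneOn_Ioi (speed_mono hp) ⟨-1, ?_⟩ h)
  rintro _ ⟨r, hr, rfl⟩
  exact (abs_le.mp (abs_speed_le pE pO hr.1)).1

lemma tendsto_speedMinus {pE pO : ℝ} (hp : pE ≤ pO) {ρ : ℝ}
    (h : (𝓝[E.speedDomain pE pO ∩ Set.Iio ρ] ρ).NeBot) :
    Tendsto (E.speed pE pO) (𝓝[E.speedDomain pE pO ∩ Set.Iio ρ] ρ)
      (𝓝 (E.speedMinus pE pO ρ)) := by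
  refine tendsto_nhds_limUnder (exists_tendsto_of_monotoneOn_Iio (speed_mono hp) ⟨1, ?_⟩ h)
  rintro _ ⟨r, hr, rfl⟩
  exact (abs_le.mp (abs_speed_le pE pO hr.1)).2

end Environment

/-! ### The two-sided deviation bound. -/

lemma four_mul_exp_neg_le {L : ℝ} (hL : 2 ^ 400 ≤ L) :
    4 * Real.exp (-L ^ (1 / 64 : ℝ)) ≤ Real.exp (-L ^ (1 / 400 : ℝ)) := by
  have hL1 : 1 ≤ L := le_trans (one_le_pow₀ (by norm_num)) hL
  set z := L ^ (1 / 400 : ℝ) with hz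
  have hz2 : 2 ≤ z := by
    calc (2 : ℝ) = ((2 : ℝ) ^ 400) ^ (1 / 400 : ℝ) := by
          rw [← Real.rpow_natCast, ← Real.rpow_mul (by norm_num)]; norm_num
      _ ≤ z := by rw [hz]; gcongr
  have h1 : z ^ 2 ≤ L ^ (1 / 64 : ℝ) := by
    rw [hz, ← Real.rpow_natCast, ← Real.rpow_mul (zero_le_one.trans hL1)]
    exact Real.rpow_le_rpow_of_exponent_le hL1 (by norm_num)
  have h2 : (4 : ℝ) ≤ Real.exp 2 := by
    have h3 := Real.add_one_le_exp (1 : ℝ)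
    have h4 : Real.exp 2 = Real.exp 1 * Real.exp 1 := by rw [← Real.exp_add]; norm_num
    nlinarith
  calc 4 * Real.exp (-L ^ (1 / 64 : ℝ)) ≤ Real.exp 2 * Real.exp (-L ^ (1 / 64 : ℝ)) := by gcongr
    _ = Real.exp (2 + -L ^ (1 / 64 : ℝ)) := (Real.exp_add _ _).symm
    _ ≤ _ := by
        refine Real.exp_le_exp.mpr ?_
        clear hL
        nlinarith

namespace Environment

variable {a b : ℝ} {E : Environment a b}

/-- One-sided deviation bound, to the right for `s = 1` and to the left for `s = -1`. -/
lemma exists_one_sided_deviation_le {ν : ℝ} (hν : 0 < ν) (hdrift : E.NoDriftIn ν)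
    (hcover : E.Covering ν) {pE pO : ℝ} (hp : pE ≤ pO) {ρ : ℝ} (hρ : ρ ∈ Set.Ioo a b)
    {s : ℤ} (hs : s = 1 ∨ s = -1) {ε : ℝ} (hε : ε ∈ Set.Ioo (0 : ℝ) 1)
    (hρε : ρ + s * ε ∈ Set.Ioo a b) {δ w : ℝ} (hδ : 0 < δ) (hδ2 : δ ≤ 2) (hw : |w| ≤ 1)
    (hspeed : ∀ᶠ L : ℕ in atTop, s * E.finiteRangeSpeed pE pO (ρ + s * ε) L ≤ w + δ / 4) :
    ∃ k₀ : ℕ, ∀ n L : ℕ, k₀ < L → 12 * (L : ℝ) / δ ≤ n →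
      (annealed (E.law ρ)).real {ω | w + δ ≤ s * (walkFrom pE pO 0 ω.1 ω.2 n / n)} ≤
        ((⌈(n : ℝ) / L⌉₊ : ℝ) - 1) ^ 2 * Real.exp (-(L : ℝ) ^ (1 / 400 : ℝ)) +
          Real.exp (-(δ ^ 2 * n) / (2 ^ 9 * L)) := by
  obtain ⟨L₀, -, hdev⟩ := exists_deviation_bound hν hdrift hcover hp
  have hg : Tendsto (fun L : ℕ => (L : ℝ) ^ (-(1 / 32) : ℝ)) atTop (𝓝 0) :=
    (tendsto_rpow_neg_atTop (by norm_num)).comp tendsto_natCast_atTop_atTop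
  have hsq : Tendsto (fun L : ℕ => √(L : ℝ)) atTop atTop :=
    Real.tendsto_sqrt_atTop.comp tendsto_natCast_atTop_atTop
  obtain ⟨k₀, hk₀⟩ := eventually_atTop.mp ((hg.eventually_le_const hε.1).and (hspeed.and
    ((hsq.eventually_ge_atTop (32 / δ)).and ((eventually_ge_atTop L₀).and
      (tendsto_natCast_atTop_atTop.eventually_ge_atTop ((2 : ℝ) ^ 400))))))
  refine ⟨k₀, fun n L hL hn => ?_⟩
  obtain ⟨hεL, hv, hroot, hL₀, hLbig⟩ := hk₀ L hL.le
  have hfour := four_mul_exp_neg_le hLbig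
  clear hLbig hk₀
  have hL1 : 0 < L := by omega
  have hL0 : (0 : ℝ) < L := by exact_mod_cast hL1
  have hnδ : 12 * (L : ℝ) ≤ n * δ := by rwa [div_le_iff₀ hδ] at hn
  have hn6 : 6 * (L : ℝ) ≤ n := by nlinarith
  have hn0 : (0 : ℝ) < n := by linarith
  set m := n / L with hm
  have hm1 : 1 ≤ m := by
    rw [hm, Nat.le_div_iff_mul_le hL1]
    have : (L : ℝ) ≤ n := by linarith
    rw [one_mul]; exact_mod_cast this
  have hm0 : (0 : ℝ) < m := by exact_mod_cast hm1
  have hmn : m * L ≤ n := Nat.div_mul_le_self n L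
  have hnm : n < m * L + L := by
    have := Nat.lt_div_mul_add (a := n) hL1
    rwa [← hm] at this
  have hmn' : (m : ℝ) * L ≤ n := by exact_mod_cast hmn
  have hnm' : (n : ℝ) ≤ m * L + L := by exact_mod_cast hnm.le
  have hw1 := abs_le.mp hw
  -- The budget `δ n` is split as `δ n / 2` for fluctuations, `δ n / 4` for the speed, `δ n / 16`
  -- for head starts, and `2 L ≤ δ n / 6` for the incomplete block, which enters once through the
  -- walk and once through `w`.
  have h := hdev L hL₀ ρ hρ ε hε.2 hεL s hs hρε m hm1 (δ * n / 2) (by positivity)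
  set v := E.finiteRangeSpeed pE pO (ρ + s * ε) L with hvdef
  have hsub : {ω : EnvPath × (ℕ → unitInterval) |
      w + δ ≤ s * (walkFrom pE pO 0 ω.1 ω.2 n / n)} ⊆
      {ω | m * (s * (L * v) + 2 * √L) + δ * n / 2 ≤ s * walkFrom pE pO 0 ω.1 ω.2 (m * L)} := by
    intro ω hω
    simp only [Set.mem_ofPred_eq] at hω ⊢
    rw [mul_div_assoc', le_div_iff₀ hn0] at hω
    have h1 : (s * walkFrom pE pO 0 ω.1 ω.2 n : ℝ) ≤
        s * walkFrom pE pO 0 ω.1 ω.2 (m * L) + L := by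
      have h3 := walkFrom_add pE pO 0 ω.1 ω.2 (n - m * L) (m * L)
      rw [Nat.add_sub_cancel' hmn] at h3
      have h4 := abs_le.mp (abs_walkFrom_sub_le pE pO (walkFrom pE pO 0 ω.1 ω.2 (m * L))
        (EnvPath.shift (m * L) 0 ω.1) (fun k => ω.2 (m * L + k)) (n - m * L))
      rw [← h3] at h4
      have h5 : ((n - m * L : ℕ) : ℤ) ≤ L := by exact_mod_cast (by omega : n - m * L ≤ L)
      have h6 : s * walkFrom pE pO 0 ω.1 ω.2 n ≤ s * walkFrom pE pO 0 ω.1 ω.2 (m * L) + L := by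
        rcases hs with rfl | rfl <;> linarith [h4.1, h4.2]
      exact_mod_cast h6
    have c1 : m * (s * (L * v)) ≤ m * L * (w + δ / 4) := by
      calc m * (s * (L * v)) = m * L * (s * v) := by ring
        _ ≤ _ := by gcongr
    have c2 : m * L * w ≤ n * w + L := by nlinarith
    have c3 : m * L * (δ / 4) ≤ n * (δ / 4) := by gcongr
    have c4 : m * (2 * √(L : ℝ)) ≤ n * (δ / 16) := by
      have hδs : 32 ≤ √(L : ℝ) * δ := by rwa [div_le_iff₀ hδ] at hroot
      have hss : √(L : ℝ) * √(L : ℝ) = L := Real.mul_self_sqrt hL0.le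
      calc m * (2 * √(L : ℝ)) = m * √(L : ℝ) * 32 / 16 := by ring
        _ ≤ m * √(L : ℝ) * (√(L : ℝ) * δ) / 16 := by gcongr
        _ = m * (√(L : ℝ) * √(L : ℝ)) * (δ / 16) := by ring
        _ = m * L * (δ / 16) := by rw [hss]
        _ ≤ _ := by gcongr
    nlinarith
  refine (measureReal_mono hsub).trans (h.trans ?_)
  rw [add_comm]
  refine add_le_add ?_ ?_
  · have hN : (n : ℝ) / L ≤ ⌈(n : ℝ) / L⌉₊ := Nat.le_ceil _
    have hmN : (m : ℝ) ≤ ⌈(n : ℝ) / L⌉₊ := le_trans (by rw [le_div_iff₀ hL0]; exact hmn') hN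
    have h6 : (6 : ℝ) ≤ n / L := by rw [le_div_iff₀ hL0]; exact hn6
    -- Since `n / L ≥ 6`, trading `m` for the ceiling minus one costs a factor 2; its square 4 is
    -- absorbed by weakening the exponent from `1 / 64` to `1 / 400`.
    have h7 : (m : ℝ) ≤ 2 * ((⌈(n : ℝ) / L⌉₊ : ℝ) - 1) := by linarith
    calc (m : ℝ) ^ 2 * Real.exp (-(L : ℝ) ^ (1 / 64 : ℝ))
        ≤ (2 * ((⌈(n : ℝ) / L⌉₊ : ℝ) - 1)) ^ 2 * Real.exp (-(L : ℝ) ^ (1 / 64 : ℝ)) := by gcongr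
      _ = ((⌈(n : ℝ) / L⌉₊ : ℝ) - 1) ^ 2 * (4 * Real.exp (-(L : ℝ) ^ (1 / 64 : ℝ))) := by ring
      _ ≤ _ := by gcongr
  · refine Real.exp_le_exp.mpr ?_
    rw [neg_div, neg_le_neg_iff, div_le_div_iff₀ (by positivity) (by positivity)]
    calc δ ^ 2 * n * (2 * m * L ^ 2) = δ ^ 2 * n * L * 2 * (m * L) := by ring
      _ ≤ δ ^ 2 * n * L * 2 * n := by gcongr
      _ ≤ δ ^ 2 * n * L * 128 * n := by gcongr; norm_num
      _ = (δ * n / 2) ^ 2 * (2 ^ 9 * L) := by ring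

end Environment

theorem lemma4p2 (a b : ℝ) (ha : 0 ≤ a) (E : Environment a b) (ν : ℝ) (hν : 0 < ν)
    (hdrift : E.NoDriftIn ν) (hcover : E.Covering ν)
    (pE pO : ℝ) (hpE : 0 ≤ pE) (hp : pE < pO) (hpO : pO ≤ 1)
    (ρ : ℝ) (hρ : ρ ∈ Set.Ioo a b) :
    -- `v⁺(ρ)` and `v⁻(ρ)` are well defined
    ((𝓝[E.speedDomain pE pO ∩ Set.Ioi ρ] ρ).NeBot ∧
      Tendsto (E.speed pE pO) (𝓝[E.speedDomain pE pO ∩ Set.Ioi ρ] ρ)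
        (𝓝 (E.speedPlus pE pO ρ)) ∧
      (𝓝[E.speedDomain pE pO ∩ Set.Iio ρ] ρ).NeBot ∧
      Tendsto (E.speed pE pO) (𝓝[E.speedDomain pE pO ∩ Set.Iio ρ] ρ)
        (𝓝 (E.speedMinus pE pO ρ))) ∧
    -- the deviation bound
    ∀ δ : ℝ, 0 < δ → ∃ k₀ : ℕ, ∀ n L : ℕ, k₀ < L → L ≤ n → 12 * (L : ℝ) / δ ≤ n →
      ∀ f : ℝ, Real.log L ^ 90 ≤ f → f ≤ (L : ℝ) ^ (1 / 10 : ℝ) →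
        (annealed (E.law ρ)).real
            {ω | (walk pE pO ω.1 ω.2 n : ℝ) / n ∉
              Set.Ioo (E.speedMinus pE pO ρ - δ) (E.speedPlus pE pO ρ + δ)} ≤
          2 * ((⌈(n : ℝ) / L⌉₊ : ℝ) - 1) ^ 2 * Real.exp (-f ^ (1 / 40 : ℝ)) +
            2 * Real.exp (-(δ ^ 2 * n) / (2 ^ 9 * L)) := by
  obtain ⟨hne₁, hne₂⟩ := Environment.neBot_speedDomain hν hdrift hcover hp.le hρ
  have ht₁ := Environment.tendsto_speedPlus hp.le hne₁
  have ht₂ := Environment.tendsto_speedMinus hp.le hne₂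
  refine ⟨⟨hne₁, ht₁, hne₂, ht₂⟩, fun δ hδ => ?_⟩
  set vp := E.speedPlus pE pO ρ with hvp
  set vm := E.speedMinus pE pO ρ with hvm
  have hvp1 : |vp| ≤ 1 := by
    refine le_of_tendsto ht₁.abs ?_
    filter_upwards [self_mem_nhdsWithin] with r hr using Environment.abs_speed_le pE pO hr.1
  have hvm1 : |vm| ≤ 1 := by
    refine le_of_tendsto ht₂.abs ?_
    filter_upwards [self_mem_nhdsWithin] with r hr using Environment.abs_speed_le pE pO hr.1
  -- Both limits and `X_n / n` lie in `[-1, 1]`, so for `δ > 2` the deviation event is empty.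
  rcases lt_or_ge 2 δ with hδ2 | hδ2
  · refine ⟨0, fun n L hL hLn _ f _ _ => ?_⟩
    have hempty : {ω : EnvPath × (ℕ → unitInterval) |
        (walk pE pO ω.1 ω.2 n : ℝ) / n ∉ Set.Ioo (vm - δ) (vp + δ)} = ∅ := by
      refine Set.eq_empty_of_forall_notMem fun ω hω => hω ?_
      have hn : (0 : ℝ) < n := by exact_mod_cast hL.trans_le hLn
      have h1 : |(walk pE pO ω.1 ω.2 n : ℝ) / n| ≤ 1 := by
        rw [walk_eq_walkFrom, abs_div, abs_of_pos hn, div_le_one hn]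
        exact abs_walkFrom_le pE pO ω.1 ω.2 n
      have h1 := abs_le.mp h1
      have h2 := abs_le.mp hvp1
      have h3 := abs_le.mp hvm1
      constructor <;> linarith
    rw [hempty, measureReal_empty]
    positivity
  -- The densities `r₁` and `r₂` depend only on `ρ` and `δ`, so the gaps to `ρ` are fixed values of
  -- `ε`, which exceed `L ^ (-1/32)` for large `L`. Distance less than 1 ensures `ε < 1`.
  obtain ⟨r₁, ⟨hr₁, hr₁ρ⟩, hr₁v, hr₁1⟩ := (eventually_mem_nhdsWithin.and
    ((ht₁.eventually_lt_const (show vp < vp + δ / 8 by linarith)).and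
      (mem_nhdsWithin_of_mem_nhds (Iio_mem_nhds (show ρ < ρ + 1 by linarith))))).exists
  obtain ⟨r₂, ⟨hr₂, hr₂ρ⟩, hr₂v, hr₂1⟩ := (eventually_mem_nhdsWithin.and
    ((ht₂.eventually_const_lt (show vm - δ / 8 < vm by linarith)).and
      (mem_nhdsWithin_of_mem_nhds (Ioi_mem_nhds (show ρ - 1 < ρ by linarith))))).exists
  simp only [Set.mem_Ioi, Set.mem_Iio] at hr₁ρ hr₁1 hr₂ρ hr₂1
  have e₁ : ρ + (1 : ℤ) * (r₁ - ρ) = r₁ := by push_cast; ring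
  have e₂ : ρ + (-1 : ℤ) * (ρ - r₂) = r₂ := by push_cast; ring
  obtain ⟨k₁, hk₁⟩ := Environment.exists_one_sided_deviation_le (E := E) hν hdrift hcover hp.le hρ
    (s := 1) (Or.inl rfl) (ε := r₁ - ρ) ⟨by linarith, by linarith⟩ (by rw [e₁]; exact hr₁.1)
    (w := vp) hδ hδ2 hvp1 (by
      rw [e₁]
      filter_upwards [(Environment.tendsto_finiteRangeSpeed pE pO hr₁).eventually_lt_const
        (show E.speed pE pO r₁ < vp + δ / 4 by linarith)] with L hL
      push_cast; linarith)
  obtain ⟨k₂, hk₂⟩ := Environment.exists_one_sided_deviation_le (E := E) hν hdrift hcover hp.le hρ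
    (s := -1) (Or.inr rfl) (ε := ρ - r₂) ⟨by linarith, by linarith⟩ (by rw [e₂]; exact hr₂.1)
    (w := -vm) hδ hδ2 (by rwa [abs_neg]) (by
      rw [e₂]
      filter_upwards [(Environment.tendsto_finiteRangeSpeed pE pO hr₂).eventually_const_lt
        (show vm - δ / 4 < E.speed pE pO r₂ by linarith)] with L hL
      push_cast; linarith)
  refine ⟨max k₁ k₂, fun n L hL hLn hn f hf1 hf2 => ?_⟩
  have h₁ := hk₁ n L ((le_max_left _ _).trans_lt hL) hn
  have h₂ := hk₂ n L ((le_max_right _ _).trans_lt hL) hn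
  have hf0 : 0 ≤ f := le_trans (Even.pow_nonneg (by decide) _) hf1
  -- The exponent `1 / 400` is `1 / 10` times `1 / 40`: the largest admissible `f` is the worst
  -- case.
  have hfL : f ^ (1 / 40 : ℝ) ≤ (L : ℝ) ^ (1 / 400 : ℝ) := by
    calc f ^ (1 / 40 : ℝ) ≤ ((L : ℝ) ^ (1 / 10 : ℝ)) ^ (1 / 40 : ℝ) := by gcongr
      _ = _ := by rw [← Real.rpow_mul (by positivity)]; norm_num
  have hexp : ((⌈(n : ℝ) / L⌉₊ : ℝ) - 1) ^ 2 * Real.exp (-(L : ℝ) ^ (1 / 400 : ℝ)) ≤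
      ((⌈(n : ℝ) / L⌉₊ : ℝ) - 1) ^ 2 * Real.exp (-f ^ (1 / 40 : ℝ)) := by gcongr
  have hsub : {ω : EnvPath × (ℕ → unitInterval) |
      (walk pE pO ω.1 ω.2 n : ℝ) / n ∉ Set.Ioo (vm - δ) (vp + δ)} ⊆
      {ω | vp + δ ≤ (1 : ℤ) * (walkFrom pE pO 0 ω.1 ω.2 n / n : ℝ)} ∪
      {ω | -vm + δ ≤ (-1 : ℤ) * (walkFrom pE pO 0 ω.1 ω.2 n / n : ℝ)} := by
    intro ω hω
    simp only [Set.mem_union, Set.mem_ofPred_eq, Set.mem_Ioo, not_and_or, not_lt,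
      walk_eq_walkFrom] at hω ⊢
    push_cast
    rcases hω with h | h
    · right; linarith
    · left; linarith
  refine (measureReal_mono hsub).trans ((measureReal_union_le _ _).trans ?_)
  linarith
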